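/- Let $\mathbb H$ and $\mathbb U$ be Hilbert spaces (over the same field $\mathbb R$ or $\mathbb C$), let $(S(t))_{t\in\mathbb R}\subset\mathcal L(\mathbb H)$ be a strongly continuous group with infinitesimal generator $(A,\mathcal D(A))$, let $A^*$ be the adjoint of $A$, so that $e^{tA^*}=S(t)^*$ for $t\in\mathbb R$, and equip $\mathcal D(A^*)$ with the graph inner product $\langle z_1,z_2\rangle_{\mathbb H}+\langle A^*z_1,A^*z_2\rangle_{\mathbb H}$. Let $\mathcal D(A^*)'$ be the dual of $\mathcal D(A^*)$ with respect to the pivot space $\mathbb H$, and let $B\in\mathcal L(\mathbb U,\mathcal D(A^*)')$ with adjoint $B^*\in\mathcal L(\mathcal D(A^*),\mathbb U)$. Assume that $B$ is an admissible control operator: for all $T'>0$ and $u\in L^2((0,T');\mathbb U)$, the function $t\mapsto\int_0^tS(t-s)Bu(s)\,ds$ belongs to $C([0,T'];\mathbb H)$. Assume that the system $y'=Ay+Bu$ is exactly controllable in some time $T>0$: for all $y_0,y_T\in\mathbb H$ there is $u\in L^2((0,T);\mathbb U)$ such that the weak solution $y\in C([0,T];\mathbb H)$ with $y(0)=y_0$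 satisfies $y(T)=y_T$. (Weak solution: for every $\varphi\in\mathcal D(A^*)$, $\frac{d}{dt}\langle y,\varphi\rangle_{\mathbb H}=\langle y,A^*\varphi\rangle_{\mathbb H}+\langle u,B^*\varphi\rangle_{\mathbb U}$ in the sense of distributions on $(0,T)$.) Let $\lambda\in\mathbb R$, $T_*>T$, let $\rho:[0,T_*]\to\mathbb R$ be Lipschitz and decreasing (not necessarily strictly) with $\rho(0)=1$, $\rho(T)>0$ and $\rho(T_*)=0$, and let $W\in\mathcal L(\mathbb U)$ be symmetric and positive, where a symmetric bounded operator $P$ is called positive if $\langle Px,x\rangle\ge C\|x\|^2$ for all $x$ and some constant $C>0$, and non-negative if $\langle Px,x\rangle\ge0$ for all $x$. Then the map $z\mapsto\big(s\mapsto B^*e^{-sA^*}z\big)$, defined for $z\in\mathcal D(A^*)$, extends uniquely to a bounded linear map $\mathbb H\to L^2((0,T_*);\mathbb U)$, for which we keep the same notation. There is a unique map $Q:\mathbb H\to\mathbb H$ with $$\langle Qz_1,z_2\rangle_{\mathbb H}=\int_0^{T_*}\rho(s)\,e^{-2\lambda s}\,\langle WB^*e^{-sA^*}z_1,\,B^*e^{-sA^*}z_2\rangle_{\mathbb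 U}\,ds\qquad\text{for all }z_1,z_2\in\mathbb H,$$ and $Q$ is linear, continuous, symmetric, positive and invertible. There is a unique map $R:\mathbb H\to\mathbb H$ with $$\langle RQz_1,Qz_2\rangle_{\mathbb H}=-\int_0^{T_*}\rho'(s)\,e^{-2\lambda s}\,\langle WB^*e^{-sA^*}z_1,\,B^*e^{-sA^*}z_2\rangle_{\mathbb U}\,ds\qquad\text{for all }z_1,z_2\in\mathbb H,$$ and $R$ is linear, continuous, symmetric and non-negative. Finally, the identity $AQ+QA^*-BWB^*+QRQ+2\lambda Q=0$ holds in the sense that, for all $x,y\in\mathcal D(A^*)$, $$\langle Qx,A^*y\rangle_{\mathbb H}+\langle A^*x,Qy\rangle_{\mathbb H}-\langle WB^*x,B^*y\rangle_{\mathbb U}+\langle RQx,Qy\rangle_{\mathbb H}+2\lambda\langle Qx,y\rangle_{\mathbb H}=0.$$ -/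

import Mathlib

open MeasureTheory Filter Topology Set
open scoped InnerProductSpace LinearPMap ContDiff

/-- A strongly continuous group `(S(t))_{t ∈ ℝ}` of bounded operators on a Hilbert space. -/
structure C0Group (𝕜 H : Type*) [RCLike 𝕜] [NormedAddCommGroup H] [InnerProductSpace 𝕜 H] where
  toFun : ℝ → H →L[𝕜] H
  map_zero : toFun 0 = ContinuousLinearMap.id 𝕜 H
  map_add : ∀ s t : ℝ, toFun (s + t) = (toFun s).comp (toFun t)
  tendsto_zero : ∀ x : H, Tendsto (fun t : ℝ => toFun t x) (𝓝 0) (𝓝 x)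

/-- The domain of a partially defined operator `T`, to be equipped with the graph inner product
`⟪z₁, z₂⟫ + ⟪T z₁, T z₂⟫`. -/
def GraphDomain {𝕜 H : Type*} [RCLike 𝕜] [NormedAddCommGroup H] [InnerProductSpace 𝕜 H]
    (T : H →ₗ.[𝕜] H) : Type _ := T.domain

namespace GraphDomain

variable {𝕜 H : Type*} [RCLike 𝕜] [NormedAddCommGroup H] [InnerProductSpace 𝕜 H]
  (T : H →ₗ.[𝕜] H)

instance instAddCommGroup : AddCommGroup (GraphDomain T) :=
  inferInstanceAs (AddCommGroup T.domain)

instance instModule : Module 𝕜 (GraphDomain T) :=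
  inferInstanceAs (Module 𝕜 T.domain)

variable {T}

/-- The inclusion of the domain of `T` into `H`. -/
def incl : GraphDomain T →ₗ[𝕜] H := T.domain.subtype

/-- The operator `T` on its domain. -/
def op : GraphDomain T →ₗ[𝕜] H := T.toFun

variable (T)

/-- The graph inner product `⟪z₁, z₂⟫ + ⟪T z₁, T z₂⟫`. -/
@[reducible]
noncomputable def core : InnerProductSpace.Core 𝕜 (GraphDomain T) where
  inner z₁ z₂ := ⟪incl z₁, incl z₂⟫_𝕜 + ⟪op z₁, op z₂⟫_𝕜
  conj_inner_symm x y := by simp only [_root_.map_add, inner_conj_symm]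
  re_inner_nonneg x := by
    rw [_root_.map_add]
    exact add_nonneg inner_self_nonneg inner_self_nonneg
  add_left x y z := by simp only [_root_.map_add, inner_add_left]; ring
  smul_left x y r := by simp only [_root_.map_smul, inner_smul_left]; ring
  definite x hx := by
    have h := congrArg RCLike.re hx
    rw [_root_.map_add, RCLike.zero_re] at h
    have h1 : 0 ≤ RCLike.re ⟪incl x, incl x⟫_𝕜 := inner_self_nonneg
    have h2 : 0 ≤ RCLike.re ⟪op x, op x⟫_𝕜 := inner_self_nonneg
    rw [inner_self_eq_norm_sq] at h h1
    have h3 : ‖(incl x : H)‖ = 0 := by nlinarith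
    exact Subtype.ext (norm_eq_zero.1 h3)

noncomputable instance instNormedAddCommGroup : NormedAddCommGroup (GraphDomain T) :=
  (core T).toNormedAddCommGroup

noncomputable instance instInnerProductSpace : InnerProductSpace 𝕜 (GraphDomain T) :=
  InnerProductSpace.ofCore (core T).toCore

end GraphDomain

namespace C0Group

variable {𝕜 H : Type*} [RCLike 𝕜] [NormedAddCommGroup H] [InnerProductSpace 𝕜 H]

/-- `y` is the limit of the difference quotients `t⁻¹ (S(t) x - x)` as `t → 0`. -/
def HasGenerator (S : C0Group 𝕜 H) (x y : H) : Prop :=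
  Tendsto (fun t : ℝ => ((t : 𝕜)⁻¹) • (S.toFun t x - x)) (𝓝[≠] 0) (𝓝 y)

theorem HasGenerator.add {S : C0Group 𝕜 H} {x y x' y' : H}
    (h : S.HasGenerator x y) (h' : S.HasGenerator x' y') :
    S.HasGenerator (x + x') (y + y') := by
  refine (Tendsto.add h h').congr fun t => ?_
  rw [_root_.map_add, ← smul_add]
  congr 1
  abel

theorem HasGenerator.smul {S : C0Group 𝕜 H} {x y : H} (c : 𝕜) (h : S.HasGenerator x y) :
    S.HasGenerator (c • x) (c • y) := by
  refine (Tendsto.const_smul h c).congr fun t => ?_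
  rw [_root_.map_smul, ← smul_sub, smul_comm]

theorem HasGenerator.unique {S : C0Group 𝕜 H} {x y y' : H}
    (h : S.HasGenerator x y) (h' : S.HasGenerator x y') : y = y' :=
  tendsto_nhds_unique h h'

theorem HasGenerator.zero (S : C0Group 𝕜 H) : S.HasGenerator 0 0 := by
  refine Tendsto.congr (f₁ := fun _ => (0 : H)) (fun t => ?_) tendsto_const_nhds
  simp

/-- The infinitesimal generator `(A, D(A))` of the group. -/
noncomputable def generator (S : C0Group 𝕜 H) : H →ₗ.[𝕜] H where
  domain :=
    { carrier := {x | ∃ y, S.HasGenerator x y}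
      add_mem' := fun ⟨_, hx⟩ ⟨_, hy⟩ => ⟨_, hx.add hy⟩
      zero_mem' := ⟨0, HasGenerator.zero S⟩
      smul_mem' := fun c _ ⟨_, hx⟩ => ⟨_, hx.smul c⟩ }
  toFun :=
    { toFun := fun x => Classical.choose x.2
      map_add' := fun x y => (Classical.choose_spec (x + y).2).unique
        ((Classical.choose_spec x.2).add (Classical.choose_spec y.2))
      map_smul' := fun c x => (Classical.choose_spec (c • x).2).unique
        ((Classical.choose_spec x.2).smul c) }

theorem generator_spec (S : C0Group 𝕜 H) (x : S.generator.domain) :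
    S.HasGenerator (x : H) (S.generator x) :=
  Classical.choose_spec x.2

theorem generator_eq (S : C0Group 𝕜 H) (x : S.generator.domain) {y : H}
    (h : S.HasGenerator (x : H) y) : S.generator x = y :=
  (S.generator_spec x).unique h

theorem HasGenerator.map {S : C0Group 𝕜 H} {x y : H} (s : ℝ) (h : S.HasGenerator x y) :
    S.HasGenerator (S.toFun s x) (S.toFun s y) := by
  refine (((S.toFun s).continuous.tendsto y).comp h).congr fun t => ?_
  have h1 : S.toFun s (S.toFun t x) = S.toFun t (S.toFun s x) := by
    have h2 := congrArg (fun f => f x) (S.map_add s t)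
    have h3 := congrArg (fun f => f x) (S.map_add t s)
    rw [add_comm t s] at h3
    exact h2.symm.trans h3
  simp only [Function.comp_apply, _root_.map_smul, _root_.map_sub, h1]

variable [CompleteSpace H]

/-- `D(A*)` with the graph inner product, where `A*` is the Hilbert space adjoint of the
(densely defined) generator `A`. -/
abbrev AdjDomain (S : C0Group 𝕜 H) : Type _ := GraphDomain (S.generator†)

/-- `S(t)*` maps `D(A*)` into itself. -/
theorem adjoint_mem (S : C0Group 𝕜 H) (t : ℝ) {z : H} (hz : z ∈ (S.generator†).domain) :
    ContinuousLinearMap.adjoint (S.toFun t) z ∈ (S.generator†).domain := by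
  rw [LinearPMap.mem_adjoint_domain_iff] at hz ⊢
  have hmem : ∀ x : S.generator.domain, S.toFun t (x : H) ∈ S.generator.domain :=
    fun x => ⟨_, (S.generator_spec x).map t⟩
  have hc : Continuous fun x : S.generator.domain =>
      (⟨S.toFun t (x : H), hmem x⟩ : S.generator.domain) :=
    ((S.toFun t).continuous.comp continuous_subtype_val).subtype_mk _
  refine (hz.comp hc).congr fun x => ?_
  have h1 : S.generator ⟨S.toFun t (x : H), hmem x⟩ = S.toFun t (S.generator x) :=
    S.generator_eq _ ((S.generator_spec x).map t)
  change ⟪z, S.generator ⟨S.toFun t (x : H), hmem x⟩⟫_𝕜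
    = ⟪ContinuousLinearMap.adjoint (S.toFun t) z, S.generator x⟫_𝕜
  rw [h1, ContinuousLinearMap.adjoint_inner_left]

/-- The element `e^{tA*} z = S(t)* z` of `D(A*)`, for `z ∈ D(A*)` and `t ∈ ℝ`. -/
noncomputable def adjOrbit (S : C0Group 𝕜 H) (t : ℝ) (z : S.AdjDomain) : S.AdjDomain :=
  (⟨ContinuousLinearMap.adjoint (S.toFun t) (GraphDomain.incl z), S.adjoint_mem t z.2⟩ :
    (S.generator†).domain)

/-- The space `D(A*)'`, the dual of `D(A*)` with respect to the pivot space `H`: bounded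
conjugate-linear functionals on `D(A*)`. An element `h` of `H` acts as `z ↦ ⟪z, h⟫`. -/
abbrev AdjDual (S : C0Group 𝕜 H) : Type _ := S.AdjDomain →L⋆[𝕜] 𝕜

variable {U : Type*} [NormedAddCommGroup U] [InnerProductSpace 𝕜 U] [CompleteSpace U]

/-- The adjoint `B* : D(A*) → U` of a control operator `B : U → D(A*)'`, characterised by
`⟪B* z, u⟫ = (B u) z`. -/
noncomputable def bStar (S : C0Group 𝕜 H) (B : U →L[𝕜] S.AdjDual) : S.AdjDomain →L[𝕜] U :=
  ((InnerProductSpace.toDual 𝕜 U).symm.toContinuousLinearEquiv :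
    StrongDual 𝕜 U →L⋆[𝕜] U).comp B.flip

theorem inner_bStar (S : C0Group 𝕜 H) (B : U →L[𝕜] S.AdjDual) (z : S.AdjDomain) (u : U) :
    ⟪S.bStar B z, u⟫_𝕜 = B u z := by
  change ⟪(InnerProductSpace.toDual 𝕜 U).symm (B.flip z), u⟫_𝕜 = B u z
  rw [InnerProductSpace.toDual_symm_apply, ContinuousLinearMap.flip_apply]

/-- `B` is an admissible control operator: for all `T > 0` and `u ∈ L²((0,T); U)`, the function
`φ(t) = ∫₀ᵗ S(t-s) B u(s) ds`, an integral in `D(A*)'`, belongs to `C([0,T]; H)`. Tested against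
`z ∈ D(A*)`, the integrand `S(t-s) B u(s)` is `(B u(s)) (S(t-s)* z)`. -/
def Admissible (S : C0Group 𝕜 H) (B : U →L[𝕜] S.AdjDual) : Prop :=
  ∀ T : ℝ, 0 < T → ∀ u : ℝ → U, MemLp u 2 (volume.restrict (Ioo 0 T)) →
    ∃ φ : ℝ → H, ContinuousOn φ (Icc 0 T) ∧
      ∀ t ∈ Icc 0 T, ∀ z : S.AdjDomain,
        ⟪GraphDomain.incl z, φ t⟫_𝕜 = ∫ s in (0 : ℝ)..t, B (u s) (S.adjOrbit (t - s) z)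

/-- `y ∈ C([0,T]; H)` is a weak solution of `y' = A y + B u` in `(0,T)`, `y(0) = y₀`: for every
`z ∈ D(A*)`, `d/dt ⟪z, y⟫ = ⟪A* z, y⟫ + ⟪B* z, u⟫` in the sense of distributions on `(0,T)`. -/
def IsWeakSolution (S : C0Group 𝕜 H) (B : U →L[𝕜] S.AdjDual) (T : ℝ) (u : ℝ → U) (y₀ : H)
    (y : ℝ → H) : Prop :=
  ContinuousOn y (Icc 0 T) ∧ y 0 = y₀ ∧
    ∀ z : S.AdjDomain, ∀ η : ℝ → ℝ, ContDiff ℝ ∞ η → HasCompactSupport η →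
      tsupport η ⊆ Ioo 0 T →
      -∫ t in Ioo 0 T, ((deriv η t : ℝ) : 𝕜) * ⟪GraphDomain.incl z, y t⟫_𝕜
        = ∫ t in Ioo 0 T, ((η t : ℝ) : 𝕜) *
            (⟪GraphDomain.op z, y t⟫_𝕜 + ⟪S.bStar B z, u t⟫_𝕜)

/-- The system `y' = A y + B u` is exactly controllable in time `T`. -/
def ExactlyControllable (S : C0Group 𝕜 H) (B : U →L[𝕜] S.AdjDual) (T : ℝ) : Prop :=
  ∀ y₀ yT : H, ∃ u : ℝ → U, MemLp u 2 (volume.restrict (Ioo 0 T)) ∧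
    ∃ y : ℝ → H, S.IsWeakSolution B T u y₀ y ∧ y T = yT

/-- `Ψ : H → L²((0,τ); U)` is the map `z ↦ (s ↦ B* e^{-sA*} z)`: a bounded operator which is given
by this formula on the (dense) subspace `D(A*)`. -/
def IsOutputMap (S : C0Group 𝕜 H) (B : U →L[𝕜] S.AdjDual) (τ : ℝ)
    (Ψ : H →L[𝕜] Lp U 2 (volume.restrict (Ioo 0 τ))) : Prop :=
  ∀ z : S.AdjDomain,
    Ψ (GraphDomain.incl z) =ᵐ[volume.restrict (Ioo 0 τ)]
      fun s => S.bStar B (S.adjOrbit (-s) z)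

/-- The sesquilinear form `∫₀^τ w(s) ⟪W (Ψ z₁)(s), (Ψ z₂)(s)⟫ ds` with a real weight `w`. -/
noncomputable def weightedForm {τ : ℝ} (Ψ : H →L[𝕜] Lp U 2 (volume.restrict (Ioo 0 τ)))
    (W : U →L[𝕜] U) (w : ℝ → ℝ) (z₁ z₂ : H) : 𝕜 :=
  ∫ s in Ioo 0 τ, ((w s : ℝ) : 𝕜) * ⟪W (Ψ z₁ s), Ψ z₂ s⟫_𝕜

/-- The operator identity `A Q + Q A* - B W B* + Q R Q + 2 λ Q = 0`, tested on `D(A*)`. -/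
def OperatorIdentity (S : C0Group 𝕜 H) (B : U →L[𝕜] S.AdjDual) (lam : ℝ)
    (Q R : H →L[𝕜] H) (W : U →L[𝕜] U) : Prop :=
  ∀ x y : S.AdjDomain,
    ⟪Q (GraphDomain.incl x), GraphDomain.op y⟫_𝕜 + ⟪GraphDomain.op x, Q (GraphDomain.incl y)⟫_𝕜
      - ⟪W (S.bStar B x), S.bStar B y⟫_𝕜
      + ⟪R (Q (GraphDomain.incl x)), Q (GraphDomain.incl y)⟫_𝕜
      + 2 * ((lam : ℝ) : 𝕜) * ⟪Q (GraphDomain.incl x), GraphDomain.incl y⟫_𝕜 = 0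

end C0Group

/-- A bounded operator is symmetric and positive in the sense of coercivity. -/
def IsCoerciveSymmetric {𝕜 X : Type*} [RCLike 𝕜] [NormedAddCommGroup X] [InnerProductSpace 𝕜 X]
    (W : X →L[𝕜] X) : Prop :=
  W.IsSymmetric ∧ ∃ C : ℝ, 0 < C ∧ ∀ x : X, C * ‖x‖ ^ 2 ≤ RCLike.re ⟪W x, x⟫_𝕜

/-! The argument is a duality argument followed by one integration by parts. Admissibility says that
every control `u` produces a state in `H` at time `Tstar`; tested on `D(A*)` and combined with
uniform boundedness, this bounds `z ↦ B* e^{-sA*} z` from the `H`-norm to `L²`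
(`Admissible.exists_norm_outputLp_le`), so it extends to `Ψ` by density of `D(A*)`. Exact
controllability gives the reverse bound on `(0, T)`: steering `y₀` to `0` writes `⟪z, y₀⟫` as a
pairing of `B* e^{-sA*} z` with a control, and uniform boundedness turns this into the observability
inequality (`ExactlyControllable.exists_norm_incl_le`). The bridge between weak solutions and that
pairing is `IsWeakSolution.inner_sub_eq`.

For a bounded weight `w`, the weighted form is represented by an operator `Ψ* N Ψ`, where `N` acts
on `L²` pointwise as `w W`. With `w = ρ e^{-2λs}`, which is nonnegative on `(0, Tstar)` and bounded
below by a positive constant on `(0, T)`, observability makes `Q` coercive (`re_weightedForm_ge`),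
hence invertible. If `M` is the operator with weight `-ρ' e^{-2λs}`, then `R = Q⁻¹ M Q⁻¹`; it is
nonnegative because `ρ' ≤ 0`.

The operator identity is the integral over `(0, Tstar)` of the derivative of `ρ(s) e^{-2λs} ⟪W B*
e^{-sA*} x, B* e^{-sA*} y⟫`; since `ρ(0) = 1` and `ρ(Tstar) = 0`, the only boundary term is `-⟪W B*
x, B* y⟫` (`weightedForm_identity`). The differentiation needs `x, y ∈ D((A*)²)`, and density in the
graph norm removes this restriction (`operatorIdentity_of_dense`). -/

namespace C0Group

/-! ### Orbits, averages and the generator of a strongly continuous group -/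

section Group

variable {𝕜 H : Type*} [RCLike 𝕜] [NormedAddCommGroup H] [InnerProductSpace 𝕜 H]

theorem toFun_add_apply (S : C0Group 𝕜 H) (s t : ℝ) (x : H) :
    S.toFun (s + t) x = S.toFun s (S.toFun t x) := by
  rw [S.map_add]; rfl

theorem toFun_zero_apply (S : C0Group 𝕜 H) (x : H) : S.toFun 0 x = x := by
  rw [S.map_zero]; rfl

theorem continuous_orbit (S : C0Group 𝕜 H) (x : H) : Continuous fun t => S.toFun t x := by
  rw [continuous_iff_continuousAt]
  intro t
  have h1 : Tendsto (fun s : ℝ => s - t) (𝓝 t) (𝓝 0) := by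
    have : Continuous fun s : ℝ => s - t := by fun_prop
    simpa using this.tendsto t
  have h2 := ((S.toFun t).continuous.tendsto x).comp ((S.tendsto_zero x).comp h1)
  refine h2.congr fun s => ?_
  simp only [Function.comp_apply]
  rw [← toFun_add_apply, add_sub_cancel]

theorem exists_norm_le [CompleteSpace H] (S : C0Group 𝕜 H) (M : ℝ) :
    ∃ C : ℝ, 0 ≤ C ∧ ∀ t, |t| ≤ M → ‖S.toFun t‖ ≤ C := by
  obtain ⟨C, hC⟩ := banach_steinhaus (g := fun t : Icc (-M) M => S.toFun t) fun x => by
    obtain ⟨C, hC⟩ := isCompact_Icc.exists_bound_of_continuousOn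
      (s := Icc (-M) M) (S.continuous_orbit x).continuousOn
    exact ⟨C, fun t => hC t t.2⟩
  exact ⟨max C 0, le_max_right _ _, fun t ht => (hC ⟨t, abs_le.1 ht⟩).trans (le_max_left _ _)⟩

variable [NormedSpace ℝ H]

theorem hasDerivAt_integral_orbit [CompleteSpace H] (S : C0Group 𝕜 H) (x : H) (t : ℝ) :
    HasDerivAt (fun t => ∫ s in (0 : ℝ)..t, S.toFun s x) (S.toFun t x) t :=
  intervalIntegral.integral_hasDerivAt_right ((S.continuous_orbit x).intervalIntegrable _ _)
    (S.continuous_orbit x).stronglyMeasurable.stronglyMeasurableAtFilter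
    (S.continuous_orbit x).continuousAt

variable [IsScalarTower ℝ 𝕜 H]

theorem hasGenerator_iff_hasDerivAt (S : C0Group 𝕜 H) {x y : H} :
    S.HasGenerator x y ↔ HasDerivAt (fun t => S.toFun t x) y 0 := by
  rw [hasDerivAt_iff_tendsto_slope_zero, HasGenerator]
  refine tendsto_congr fun t => ?_
  rw [zero_add, toFun_zero_apply, ← RCLike.ofReal_inv, RCLike.real_smul_eq_coe_smul (K := 𝕜)]

theorem HasGenerator.hasDerivAt {S : C0Group 𝕜 H} {x y : H} (h : S.HasGenerator x y) (t : ℝ) :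
    HasDerivAt (fun t => S.toFun t x) (S.toFun t y) t := by
  have h1 := (S.hasGenerator_iff_hasDerivAt).1 (h.map t)
  have h2 : HasDerivAt (fun s => S.toFun (s - t) (S.toFun t x)) (S.toFun t y) t := by
    have := HasDerivAt.scomp (h := fun s : ℝ => s - t) t (by simpa using h1)
      ((hasDerivAt_id t).sub_const t)
    simpa [Function.comp_def] using this
  refine h2.congr_of_eventuallyEq (Eventually.of_forall fun s => ?_)
  simp only
  rw [← toFun_add_apply, sub_add_cancel]

variable [CompleteSpace H]

theorem HasGenerator.integral_eq {S : C0Group 𝕜 H} {x y : H} (h : S.HasGenerator x y) (t : ℝ) :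
    ∫ s in (0 : ℝ)..t, S.toFun s y = S.toFun t x - x := by
  rw [intervalIntegral.integral_eq_sub_of_hasDerivAt (f := fun t => S.toFun t x)
    (fun s _ => h.hasDerivAt s) ((S.continuous_orbit y).intervalIntegrable _ _), toFun_zero_apply]

/-- Applying `S(t)` translates the window of integration to `[t, t + h]`, so only the two endpoints
contribute to the derivative at `t = 0`. -/
theorem hasGenerator_integral (S : C0Group 𝕜 H) (x : H) (h : ℝ) :
    S.HasGenerator (∫ s in (0 : ℝ)..h, S.toFun s x) (S.toFun h x - x) := by
  rw [hasGenerator_iff_hasDerivAt]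
  have h1 : (fun t => S.toFun t (∫ s in (0 : ℝ)..h, S.toFun s x)) =
      fun t => (∫ s in (0 : ℝ)..(t + h), S.toFun s x) - ∫ s in (0 : ℝ)..t, S.toFun s x := by
    funext t
    rw [← ContinuousLinearMap.intervalIntegral_comp_comm _
      ((S.continuous_orbit x).intervalIntegrable _ _)]
    simp_rw [← toFun_add_apply]
    rw [intervalIntegral.integral_comp_add_left (fun s => S.toFun s x), add_zero,
      intervalIntegral.integral_interval_sub_left] <;>
    exact (S.continuous_orbit x).intervalIntegrable _ _
  rw [h1]
  have h2 := (S.hasDerivAt_integral_orbit x (0 + h)).comp_add_const 0 h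
  have h3 := S.hasDerivAt_integral_orbit x 0
  rw [toFun_zero_apply] at h3
  rw [zero_add] at h2
  exact h2.sub h3

theorem tendsto_average_orbit (S : C0Group 𝕜 H) (x : H) :
    Tendsto (fun h : ℝ => (h : 𝕜)⁻¹ • ∫ s in (0 : ℝ)..h, S.toFun s x) (𝓝[≠] 0) (𝓝 x) := by
  have h := S.hasDerivAt_integral_orbit x 0
  rw [hasDerivAt_iff_tendsto_slope_zero, toFun_zero_apply] at h
  refine h.congr fun t => ?_
  rw [zero_add, intervalIntegral.integral_same, sub_zero, ← RCLike.ofReal_inv,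
    RCLike.real_smul_eq_coe_smul (K := 𝕜)]

theorem dense_generator_domain (S : C0Group 𝕜 H) : Dense (S.generator.domain : Set H) := by
  intro x
  refine mem_closure_of_tendsto (S.tendsto_average_orbit x) (Eventually.of_forall fun h => ?_)
  exact ⟨_, (S.hasGenerator_integral x h).smul _⟩

/-- The bounded operator `x ↦ ∫₀ʰ S(s) x ds`. -/
noncomputable def orbitIntegral (S : C0Group 𝕜 H) (h : ℝ) : H →L[𝕜] H :=
  LinearMap.mkContinuousOfExistsBound
    { toFun := fun x => ∫ s in (0 : ℝ)..h, S.toFun s x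
      map_add' := fun x y => by
        simp_rw [_root_.map_add]
        exact intervalIntegral.integral_add ((S.continuous_orbit x).intervalIntegrable _ _)
          ((S.continuous_orbit y).intervalIntegrable _ _)
      map_smul' := fun c x => by
        simp_rw [_root_.map_smul]
        exact intervalIntegral.integral_smul c _ } (by
    obtain ⟨C, hC, hb⟩ := S.exists_norm_le |h|
    refine ⟨C * |h - 0|, fun x => ?_⟩
    calc _ ≤ (C * ‖x‖) * |h - 0| := by
          refine intervalIntegral.norm_integral_le_of_norm_le_const fun s hs => ?_
          refine (S.toFun s).le_of_opNorm_le (hb s ?_) x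
          rw [mem_uIoc] at hs
          rw [abs_le]
          rcases hs with hs | hs
          · have := abs_of_nonneg (hs.1.le.trans hs.2)
            constructor <;> linarith
          · have := abs_of_nonpos (hs.1.le.trans hs.2)
            constructor <;> linarith
      _ = _ := by ring)

theorem orbitIntegral_apply (S : C0Group 𝕜 H) (h : ℝ) (x : H) :
    S.orbitIntegral h x = ∫ s in (0 : ℝ)..h, S.toFun s x := rfl

end Group

/-! ### The adjoint group and its generator -/

section Adjoint

variable {𝕜 H : Type*} [RCLike 𝕜] [NormedAddCommGroup H] [InnerProductSpace 𝕜 H] [CompleteSpace H]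
  [NormedSpace ℝ H] [IsScalarTower ℝ 𝕜 H]

theorem inner_op_eq (S : C0Group 𝕜 H) (z : S.AdjDomain) {x y : H} (h : S.HasGenerator x y) :
    ⟪GraphDomain.op z, x⟫_𝕜 = ⟪GraphDomain.incl z, y⟫_𝕜 := by
  have h1 := LinearPMap.adjoint_isFormalAdjoint S.dense_generator_domain z ⟨x, y, h⟩
  rw [S.generator_eq ⟨x, y, h⟩ h] at h1
  exact h1

theorem exists_adjDomain_of_inner (S : C0Group 𝕜 H) {z w : H}
    (h : ∀ x y, S.HasGenerator x y → ⟪w, x⟫_𝕜 = ⟪z, y⟫_𝕜) :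
    ∃ z' : S.AdjDomain, GraphDomain.incl z' = z ∧ GraphDomain.op z' = w := by
  have h' : ∀ x : S.generator.domain, ⟪w, (x : H)⟫_𝕜 = ⟪z, S.generator x⟫_𝕜 :=
    fun x => h _ _ (S.generator_spec x)
  have hz := LinearPMap.mem_adjoint_domain_of_exists (T := S.generator) z ⟨w, h'⟩
  exact ⟨(⟨z, hz⟩ : (S.generator†).domain), rfl,
    LinearPMap.adjoint_apply_eq S.dense_generator_domain ⟨z, hz⟩ h'⟩

/-- Orbit integrals always lie in `D(A)`, so this integrated adjoint relation holds for every `x` in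
`H`. -/
theorem inner_incl_orbit_sub (S : C0Group 𝕜 H) (z : S.AdjDomain) (t : ℝ) (x : H) :
    ⟪GraphDomain.incl z, S.toFun t x - x⟫_𝕜 = ⟪GraphDomain.op z, ∫ s in (0 : ℝ)..t, S.toFun s x⟫_𝕜 :=
  (S.inner_op_eq z (S.hasGenerator_integral x t)).symm

/-- With `J_h` the orbit integral, `J_h*` maps `H` into `D(A*)`, where `A* J_h* z = S(h)* z - z`. A
vector `y` orthogonal to `D(A*)` therefore has `J_h y = 0` for all `h`, and the averages `h⁻¹ J_h y`
tend to `y`. -/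
theorem dense_range_incl (S : C0Group 𝕜 H) :
    DenseRange (GraphDomain.incl : S.AdjDomain →ₗ[𝕜] H) := by
  have key : (LinearMap.range (GraphDomain.incl : S.AdjDomain →ₗ[𝕜] H))ᗮ = ⊥ := by
    rw [Submodule.eq_bot_iff]
    intro y hy
    rw [Submodule.mem_orthogonal] at hy
    have h1 : ∀ h : ℝ, S.orbitIntegral h y = 0 := fun h => by
      refine ext_inner_left 𝕜 fun z => ?_
      obtain ⟨z', hz', -⟩ := S.exists_adjDomain_of_inner
        (z := ContinuousLinearMap.adjoint (S.orbitIntegral h) z)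
        (w := ContinuousLinearMap.adjoint (S.toFun h) z - z) fun a b hab => by
          rw [inner_sub_left, ContinuousLinearMap.adjoint_inner_left,
            ContinuousLinearMap.adjoint_inner_left, orbitIntegral_apply, hab.integral_eq,
            inner_sub_right]
      have := hy _ ⟨z', hz'⟩
      rw [ContinuousLinearMap.adjoint_inner_left] at this
      rw [this, inner_zero_right]
    refine tendsto_nhds_unique (S.tendsto_average_orbit y) (tendsto_const_nhds.congr fun h => ?_)
    rw [← orbitIntegral_apply, h1, smul_zero]
  have := (Submodule.topologicalClosure_eq_top_iff).2 key
  intro x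
  have hx : x ∈ (LinearMap.range (GraphDomain.incl : S.AdjDomain →ₗ[𝕜] H)).topologicalClosure := by
    rw [this]; trivial
  rwa [← SetLike.mem_coe, Submodule.topologicalClosure_coe, LinearMap.coe_range] at hx

/-- On `D(A*)` the integrated adjoint relation gives `‖S(t)* z - z‖ ≤ C ‖A* z‖ |t|` for `|t| ≤ 1`;
density and the local uniform bound on `‖S(t)*‖` extend the convergence to `H`. -/
theorem tendsto_adjoint_orbit (S : C0Group 𝕜 H) (x : H) :
    Tendsto (fun t => ContinuousLinearMap.adjoint (S.toFun t) x) (𝓝 0) (𝓝 x) := by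
  obtain ⟨C, hC, hb⟩ := S.exists_norm_le 1
  have hnear : ∀ᶠ t : ℝ in 𝓝 0, |t| ≤ 1 := by
    filter_upwards [Metric.closedBall_mem_nhds (0 : ℝ) one_pos] with t ht
    simpa using ht
  have hdom : ∀ z : S.AdjDomain, Tendsto (fun t => ContinuousLinearMap.adjoint (S.toFun t)
      (GraphDomain.incl z)) (𝓝 0) (𝓝 (GraphDomain.incl z)) := fun z => by
    rw [tendsto_iff_norm_sub_tendsto_zero]
    refine squeeze_zero' (g := fun t => ‖GraphDomain.op z‖ * C * |t|)
      (Eventually.of_forall fun _ => norm_nonneg _) ?_ ?_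
    · filter_upwards [hnear] with t ht
      refine ContinuousLinearMap.opNorm_le_bound (innerSL 𝕜 (ContinuousLinearMap.adjoint
        (S.toFun t) (GraphDomain.incl z) - GraphDomain.incl z)) (by positivity) (fun y => ?_)
        |> (innerSL_apply_norm (𝕜 := 𝕜) _).symm.le.trans
      rw [innerSL_apply_apply, inner_sub_left, ContinuousLinearMap.adjoint_inner_left,
        ← inner_sub_right, S.inner_incl_orbit_sub]
      refine (norm_inner_le_norm _ _).trans ?_
      have : ‖∫ s in (0 : ℝ)..t, S.toFun s y‖ ≤ (C * ‖y‖) * |t - 0| := by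
        refine intervalIntegral.norm_integral_le_of_norm_le_const fun s hs => ?_
        refine (S.toFun s).le_of_opNorm_le (hb s ?_) y
        rw [abs_le] at ht
        rw [mem_uIoc] at hs
        rw [abs_le]
        rcases hs with hs | hs <;> constructor <;> linarith
      rw [sub_zero] at this
      calc _ ≤ ‖GraphDomain.op z‖ * ((C * ‖y‖) * |t|) := by gcongr
        _ = _ := by ring
    · have : Continuous fun t : ℝ => ‖GraphDomain.op z‖ * C * |t| := by fun_prop
      simpa using this.tendsto 0
  rw [Metric.tendsto_nhds]
  intro ε hε
  obtain ⟨z, hz⟩ := S.dense_range_incl.exists_dist_lt x (ε := ε / (2 * (C + 1))) (by positivity)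
  have hz' : ‖x - GraphDomain.incl z‖ * (C + 1) < ε / 2 := by
    rw [dist_eq_norm, lt_div_iff₀ (by positivity)] at hz
    linarith
  filter_upwards [hnear, (Metric.tendsto_nhds.1 (hdom z)) (ε / 2) (by positivity)] with t ht h2
  have h3 : ContinuousLinearMap.adjoint (S.toFun t) x - x =
      ContinuousLinearMap.adjoint (S.toFun t) (x - GraphDomain.incl z) +
      (ContinuousLinearMap.adjoint (S.toFun t) (GraphDomain.incl z) - GraphDomain.incl z) -
      (x - GraphDomain.incl z) := by
    rw [_root_.map_sub]; abel
  have h4 : ‖ContinuousLinearMap.adjoint (S.toFun t) (x - GraphDomain.incl z)‖ ≤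
      C * ‖x - GraphDomain.incl z‖ := by
    refine ContinuousLinearMap.le_of_opNorm_le _ ?_ _
    rw [LinearIsometryEquiv.norm_map]
    exact hb t ht
  rw [dist_eq_norm] at h2 ⊢
  rw [h3]
  refine (norm_sub_le _ _).trans_lt ?_
  have := norm_add_le (ContinuousLinearMap.adjoint (S.toFun t) (x - GraphDomain.incl z))
    (ContinuousLinearMap.adjoint (S.toFun t) (GraphDomain.incl z) - GraphDomain.incl z)
  linarith

/-- The adjoint group `t ↦ S(t)*`. -/
noncomputable def adjGroup (S : C0Group 𝕜 H) : C0Group 𝕜 H where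
  toFun t := ContinuousLinearMap.adjoint (S.toFun t)
  map_zero := by rw [S.map_zero, ContinuousLinearMap.adjoint_id]
  map_add s t := by rw [add_comm, S.map_add, ContinuousLinearMap.adjoint_comp]
  tendsto_zero := S.tendsto_adjoint_orbit

theorem incl_adjOrbit (S : C0Group 𝕜 H) (t : ℝ) (z : S.AdjDomain) :
    GraphDomain.incl (S.adjOrbit t z) = S.adjGroup.toFun t (GraphDomain.incl z) := rfl

theorem inner_adjGroup_left (S : C0Group 𝕜 H) (t : ℝ) (x y : H) :
    ⟪S.adjGroup.toFun t x, y⟫_𝕜 = ⟪x, S.toFun t y⟫_𝕜 :=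
  ContinuousLinearMap.adjoint_inner_left _ _ _

/-- Testing against `x` shows `S(t)* z = z + ∫₀ᵗ S(s)* A* z ds`, which is then differentiated at
`0`. Together with `HasGenerator.exists_adjDomain`, this identifies `A*` as the generator of the
adjoint group. -/
theorem hasGenerator_adjGroup (S : C0Group 𝕜 H) (z : S.AdjDomain) :
    S.adjGroup.HasGenerator (GraphDomain.incl z) (GraphDomain.op z) := by
  have h1 : ∀ t : ℝ, S.adjGroup.toFun t (GraphDomain.incl z) =
      (∫ s in (0 : ℝ)..t, S.adjGroup.toFun s (GraphDomain.op z)) + GraphDomain.incl z := fun t => by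
    refine ext_inner_right 𝕜 fun x => ?_
    rw [inner_add_left, ← sub_eq_iff_eq_add, inner_adjGroup_left, ← inner_sub_right,
      inner_incl_orbit_sub]
    rw [← inner_conj_symm _ x, ← innerSL_apply_apply 𝕜 x,
      ← ContinuousLinearMap.intervalIntegral_comp_comm _
        ((S.adjGroup.continuous_orbit _).intervalIntegrable _ _),
      ← innerSL_apply_apply 𝕜 (GraphDomain.op z),
      ← ContinuousLinearMap.intervalIntegral_comp_comm _
        ((S.continuous_orbit _).intervalIntegrable _ _), ← intervalIntegral.intervalIntegral_conj]
    refine intervalIntegral.integral_congr fun s _ => ?_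
    simp only [innerSL_apply_apply, inner_conj_symm, inner_adjGroup_left]
  rw [hasGenerator_iff_hasDerivAt]
  have h2 := (S.adjGroup.hasDerivAt_integral_orbit (GraphDomain.op z) 0).add_const
    (GraphDomain.incl z)
  rw [toFun_zero_apply] at h2
  exact h2.congr_of_eventuallyEq (Eventually.of_forall h1)

theorem HasGenerator.exists_adjDomain {S : C0Group 𝕜 H} {z w : H}
    (h : S.adjGroup.HasGenerator z w) :
    ∃ z' : S.AdjDomain, GraphDomain.incl z' = z ∧ GraphDomain.op z' = w := by
  refine S.exists_adjDomain_of_inner fun x y hxy => ?_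
  have h1 := (Tendsto.inner (𝕜 := 𝕜) h (tendsto_const_nhds (x := x)))
  have h2 := (Tendsto.inner (𝕜 := 𝕜) (tendsto_const_nhds (x := z)) hxy)
  refine tendsto_nhds_unique h1 (h2.congr fun t => ?_)
  simp only [inner_smul_left, inner_smul_right, inner_sub_left, inner_sub_right,
    inner_adjGroup_left, map_inv₀, RCLike.conj_ofReal]

end Adjoint

end C0Group

/-! ### Scalar weak derivatives, by smoothed indicator functions -/

theorem deriv_smoothTransition_of_nonpos {x : ℝ} (hx : x ≤ 0) :
    deriv Real.smoothTransition x = 0 := by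
  refine IsLocalMin.deriv_eq_zero (Eventually.of_forall fun t => ?_)
  rw [Real.smoothTransition.zero_of_nonpos hx]
  exact Real.smoothTransition.nonneg t

theorem deriv_smoothTransition_of_one_le {x : ℝ} (hx : 1 ≤ x) :
    deriv Real.smoothTransition x = 0 := by
  refine IsLocalMax.deriv_eq_zero (Eventually.of_forall fun t => ?_)
  rw [Real.smoothTransition.one_of_one_le hx]
  exact Real.smoothTransition.le_one t

theorem hasDerivAt_smoothTransition_scaled (ε c t : ℝ) :
    HasDerivAt (fun t => Real.smoothTransition (ε⁻¹ * (t - c)))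
      (ε⁻¹ * deriv Real.smoothTransition (ε⁻¹ * (t - c))) t := by
  have h1 : HasDerivAt Real.smoothTransition (deriv Real.smoothTransition (ε⁻¹ * (t - c)))
      (ε⁻¹ * (t - c)) :=
    ((Real.smoothTransition.contDiff (n := 1)).differentiable (by norm_num) _).hasDerivAt
  have h2 : HasDerivAt (fun t => ε⁻¹ * (t - c)) ε⁻¹ t := by
    simpa using ((hasDerivAt_id t).sub_const c).const_mul ε⁻¹
  rw [mul_comm]
  exact h1.comp t h2

section WeakDerivative

variable {𝕜 : Type*} [RCLike 𝕜]

/-- The kernel is an approximate identity carried by `[c, c + ε]`. The substitution `t = ε s + c`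
gives an integral over `[0, 1]` that is continuous in `ε`, with value `g c` at `ε = 0`. -/
theorem tendsto_integral_deriv_smoothTransition {T c : ℝ} (hc : c ∈ Ioo 0 T) {g : ℝ → 𝕜}
    (hg : ContinuousOn g (Icc 0 T)) :
    Tendsto (fun ε : ℝ => ∫ t in Ioo 0 T,
      ((ε⁻¹ * deriv Real.smoothTransition (ε⁻¹ * (t - c)) : ℝ) : 𝕜) * g t) (𝓝[>] 0) (𝓝 (g c)) := by
  have hT : (0 : ℝ) ≤ T := (hc.1.trans hc.2).le
  set φ := Real.smoothTransition with hφ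
  have hφc : Continuous (deriv φ) :=
    (Real.smoothTransition.contDiff (n := 1)).continuous_deriv (by norm_num)
  -- A globally continuous extension makes the substituted integral continuous in all real `ε`.
  set g' : ℝ → 𝕜 := IccExtend hT ((Icc 0 T).domRestrict g) with hg'
  have hg'c : Continuous g' := (continuousOn_iff_continuous_domRestrict.1 hg).Icc_extend'
  have hgg' : ∀ t ∈ Icc 0 T, g' t = g t := fun t ht => by
    rw [hg', IccExtend_of_mem _ _ ht]; rfl
  have h1 : Continuous fun ε : ℝ => ∫ s in (0 : ℝ)..1, ((deriv φ s : ℝ) : 𝕜) * g' (ε * s + c) := by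
    refine intervalIntegral.continuous_parametric_intervalIntegral_of_continuous' ?_ _ _
    simp only [Function.uncurry_def]
    exact (RCLike.continuous_ofReal.comp (hφc.comp continuous_snd)).mul
      (hg'c.comp (by fun_prop))
  have h2 : ∫ s in (0 : ℝ)..1, ((deriv φ s : ℝ) : 𝕜) * g' (0 * s + c) = g c := by
    simp only [zero_mul, zero_add]
    rw [intervalIntegral.integral_mul_const, RCLike.intervalIntegral_ofReal,
      intervalIntegral.integral_deriv_eq_sub, hφ, Real.smoothTransition.one,
      Real.smoothTransition.zero, hgg' c ⟨hc.1.le, hc.2.le⟩]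
    · simp
    · exact fun x _ => (Real.smoothTransition.contDiff (n := 1)).differentiable (by norm_num) x
    · exact hφc.intervalIntegrable _ _
  rw [← h2]
  refine ((h1.tendsto 0).mono_left nhdsWithin_le_nhds).congr' ?_
  have hev : ∀ᶠ ε : ℝ in 𝓝[>] 0, ε < T - c :=
    nhdsWithin_le_nhds (eventually_lt_nhds (sub_pos.2 hc.2))
  filter_upwards [hev, self_mem_nhdsWithin] with ε hε hε0
  have hε0 : 0 < ε := hε0
  have h3 : ∫ t in Ioo 0 T, ((ε⁻¹ * deriv φ (ε⁻¹ * (t - c)) : ℝ) : 𝕜) * g t =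
      ∫ t in Ioc c (c + ε), ((ε⁻¹ * deriv φ (ε⁻¹ * (t - c)) : ℝ) : 𝕜) * g' t := by
    rw [setIntegral_eq_of_subset_of_forall_sdiff_eq_zero (s := Ioc c (c + ε)) measurableSet_Ioo]
    · refine setIntegral_congr_fun measurableSet_Ioc fun t ht => ?_
      rw [hgg' t ⟨hc.1.le.trans ht.1.le, by linarith [ht.2]⟩]
    · exact fun t ht => ⟨hc.1.trans ht.1, by linarith [ht.2]⟩
    · intro t ht
      have : deriv φ (ε⁻¹ * (t - c)) = 0 := by
        by_cases h : t ≤ c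
        · exact deriv_smoothTransition_of_nonpos
            (mul_nonpos_of_nonneg_of_nonpos (inv_pos.2 hε0).le (sub_nonpos.2 h))
        · refine deriv_smoothTransition_of_one_le ?_
          have h' : c + ε ≤ t := by
            by_contra h''
            exact ht.2 ⟨not_le.1 h, (not_le.1 h'').le⟩
          rw [inv_mul_eq_div, one_le_div hε0]
          linarith
      rw [this]; simp
  rw [h3, ← intervalIntegral.integral_of_le (by linarith)]
  have h4 := intervalIntegral.smul_integral_comp_mul_add (a := 0) (b := 1)
    (fun t => ((ε⁻¹ * deriv φ (ε⁻¹ * (t - c)) : ℝ) : 𝕜) * g' t) ε c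
  rw [mul_zero, zero_add, mul_one, add_comm ε c] at h4
  rw [← h4, ← intervalIntegral.integral_smul]
  refine intervalIntegral.integral_congr fun s _ => ?_
  rw [add_sub_cancel_right, inv_mul_cancel_left₀ hε0.ne', RCLike.real_smul_eq_coe_mul, ← mul_assoc,
    ← RCLike.ofReal_mul, mul_inv_cancel_left₀ hε0.ne']

theorem tendsto_smoothTransition_scaled (c t : ℝ) :
    Tendsto (fun ε : ℝ => Real.smoothTransition (ε⁻¹ * (t - c))) (𝓝[>] 0)
      (𝓝 ((Ioi c).indicator 1 t)) := by
  refine tendsto_const_nhds.congr' ?_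
  by_cases h : c < t
  · have hev : ∀ᶠ ε : ℝ in 𝓝[>] 0, ε < t - c :=
      nhdsWithin_le_nhds (eventually_lt_nhds (sub_pos.2 h))
    filter_upwards [hev, self_mem_nhdsWithin] with ε hε hε0
    rw [indicator_of_mem (show t ∈ Ioi c from h), Real.smoothTransition.one_of_one_le]
    · rfl
    · rw [inv_mul_eq_div, one_le_div hε0]; exact hε.le
  · filter_upwards [self_mem_nhdsWithin] with ε hε0
    rw [indicator_of_notMem (show t ∉ Ioi c from h), Real.smoothTransition.zero_of_nonpos]
    exact mul_nonpos_of_nonneg_of_nonpos (inv_pos.2 hε0).le (sub_nonpos.2 (not_lt.1 h))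

/-- The test functions `η ε` are smoothed indicators of `(a, b]`: their derivatives concentrate at
`a` and `b`, while they converge pointwise and boundedly to the indicator. -/
theorem sub_eq_integral_of_weakDeriv_Ioo {T a b : ℝ} {g h : ℝ → 𝕜} (hg : ContinuousOn g (Icc 0 T))
    (hh : IntegrableOn h (Ioo 0 T))
    (hw : ∀ η : ℝ → ℝ, ContDiff ℝ ∞ η → HasCompactSupport η → tsupport η ⊆ Ioo 0 T →
      -∫ t in Ioo 0 T, ((deriv η t : ℝ) : 𝕜) * g t = ∫ t in Ioo 0 T, ((η t : ℝ) : 𝕜) * h t)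
    (ha : 0 < a) (hab : a ≤ b) (hb : b < T) : g b - g a = ∫ t in a..b, h t := by
  set φ := Real.smoothTransition with hφ
  let η : ℝ → ℝ → ℝ := fun ε t => φ (ε⁻¹ * (t - a)) - φ (ε⁻¹ * (t - b))
  have hφc : Continuous (deriv φ) :=
    (Real.smoothTransition.contDiff (n := 1)).continuous_deriv (by norm_num)
  have hd : ∀ ε t, deriv (η ε) t =
      ε⁻¹ * deriv φ (ε⁻¹ * (t - a)) - ε⁻¹ * deriv φ (ε⁻¹ * (t - b)) := fun ε t =>
    ((hasDerivAt_smoothTransition_scaled ε a t).sub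
      (hasDerivAt_smoothTransition_scaled ε b t)).deriv
  have hlim1 : Tendsto (fun ε => -∫ t in Ioo 0 T, ((deriv (η ε) t : ℝ) : 𝕜) * g t) (𝓝[>] 0)
      (𝓝 (g b - g a)) := by
    have := (tendsto_integral_deriv_smoothTransition ⟨ha, hab.trans_lt hb⟩ hg).sub
      (tendsto_integral_deriv_smoothTransition ⟨ha.trans_le hab, hb⟩ hg) |>.neg
    rw [neg_sub] at this
    refine this.congr fun ε => ?_
    have hi : ∀ c, IntegrableOn (fun t => ((ε⁻¹ * deriv φ (ε⁻¹ * (t - c)) : ℝ) : 𝕜) * g t)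
        (Ioo 0 T) := fun c => by
      refine (ContinuousOn.integrableOn_Icc ?_).mono_set Ioo_subset_Icc_self
      exact ContinuousOn.mul (RCLike.continuous_ofReal.comp (continuous_const.mul
        (hφc.comp (by fun_prop)))).continuousOn hg
    rw [← integral_sub (hi a) (hi b)]
    congr 1
    refine integral_congr_ae (Eventually.of_forall fun t => ?_)
    simp only
    rw [hd, RCLike.ofReal_sub, sub_mul]
  have hlim2 : Tendsto (fun ε => ∫ t in Ioo 0 T, ((η ε t : ℝ) : 𝕜) * h t) (𝓝[>] 0)
      (𝓝 (∫ t in a..b, h t)) := by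
    have e1 : ∫ t in a..b, h t = ∫ t in Ioo 0 T,
        (((Ioi a).indicator 1 t - (Ioi b).indicator 1 t : ℝ) : 𝕜) * h t := by
      rw [intervalIntegral.integral_of_le hab,
        setIntegral_eq_of_subset_of_forall_sdiff_eq_zero (s := Ioc a b) measurableSet_Ioo]
      · refine setIntegral_congr_fun measurableSet_Ioc fun t ht => ?_
        rw [indicator_of_mem (show t ∈ Ioi a from ht.1),
          indicator_of_notMem (show t ∉ Ioi b from not_lt.2 ht.2)]
        simp
      · exact fun t ht => ⟨ha.trans ht.1, ht.2.trans_lt hb⟩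
      · intro t ht
        by_cases h1 : a < t
        · have h2 : b < t := by
            by_contra h2
            exact ht.2 ⟨h1, not_lt.1 h2⟩
          rw [indicator_of_mem (show t ∈ Ioi a from h1), indicator_of_mem (show t ∈ Ioi b from h2)]
          simp
        · have h2 : ¬ b < t := fun h2 => h1 (hab.trans_lt h2)
          rw [indicator_of_notMem (show t ∉ Ioi a from h1),
            indicator_of_notMem (show t ∉ Ioi b from h2)]
          simp
    rw [e1]
    refine tendsto_integral_filter_of_dominated_convergence (fun t => ‖h t‖) ?_ ?_ hh.norm ?_
    · refine Eventually.of_forall fun ε => ?_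
      have : Continuous (η ε) :=
        (Real.smoothTransition.continuous.comp (by fun_prop)).sub
          (Real.smoothTransition.continuous.comp (by fun_prop))
      exact (RCLike.continuous_ofReal.comp this).aestronglyMeasurable.mul hh.aestronglyMeasurable
    · refine Eventually.of_forall fun ε => Eventually.of_forall fun t => ?_
      rw [norm_mul, RCLike.norm_ofReal]
      refine mul_le_of_le_one_left (norm_nonneg _) ?_
      have h1 := Real.smoothTransition.nonneg (ε⁻¹ * (t - a))
      have h2 := Real.smoothTransition.nonneg (ε⁻¹ * (t - b))
      have h3 := Real.smoothTransition.le_one (ε⁻¹ * (t - a))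
      have h4 := Real.smoothTransition.le_one (ε⁻¹ * (t - b))
      rw [abs_le]
      constructor <;> simp only [η, hφ] <;> linarith
    · refine Eventually.of_forall fun t => ?_
      exact ((RCLike.continuous_ofReal.tendsto _).comp ((tendsto_smoothTransition_scaled a t).sub
        (tendsto_smoothTransition_scaled b t))).mul_const _
  refine tendsto_nhds_unique hlim1 (hlim2.congr' ?_)
  have hev : ∀ᶠ ε : ℝ in 𝓝[>] 0, ε < T - b :=
    nhdsWithin_le_nhds (eventually_lt_nhds (sub_pos.2 hb))
  filter_upwards [hev, self_mem_nhdsWithin] with ε hε hε0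
  have hε0 : 0 < ε := hε0
  have hsupp : tsupport (η ε) ⊆ Icc a (b + ε) := by
    refine closure_minimal (fun t ht => ?_) isClosed_Icc
    by_contra hn
    refine ht ?_
    by_cases h1 : t < a
    · simp only [η, hφ]
      rw [Real.smoothTransition.zero_of_nonpos, Real.smoothTransition.zero_of_nonpos, sub_zero] <;>
      exact mul_nonpos_of_nonneg_of_nonpos (inv_pos.2 hε0).le (by linarith)
    · have h2 : b + ε < t := by
        by_contra h2
        exact hn ⟨not_lt.1 h1, not_lt.1 h2⟩
      simp only [η, hφ]
      rw [Real.smoothTransition.one_of_one_le, Real.smoothTransition.one_of_one_le, sub_self] <;>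
      · rw [inv_mul_eq_div, one_le_div hε0]
        linarith
  refine (hw (η ε) ?_ ?_ ?_).symm
  · exact (Real.smoothTransition.contDiff.comp (by fun_prop)).sub
      (Real.smoothTransition.contDiff.comp (by fun_prop))
  · exact HasCompactSupport.intro isCompact_Icc fun t ht => by
      by_contra h0
      exact ht (hsupp (subset_tsupport _ h0))
  · exact fun t ht => ⟨ha.trans_le (hsupp ht).1, (hsupp ht).2.trans_lt (by linarith)⟩

/-- A continuous function on `[0, T]` with an integrable distributional derivative is a primitive
of that derivative. -/
theorem sub_eq_integral_of_weakDeriv {T : ℝ} {g h : ℝ → 𝕜} (hg : ContinuousOn g (Icc 0 T))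
    (hh : IntegrableOn h (Ioo 0 T))
    (hw : ∀ η : ℝ → ℝ, ContDiff ℝ ∞ η → HasCompactSupport η → tsupport η ⊆ Ioo 0 T →
      -∫ t in Ioo 0 T, ((deriv η t : ℝ) : 𝕜) * g t = ∫ t in Ioo 0 T, ((η t : ℝ) : 𝕜) * h t)
    {a b : ℝ} (ha : 0 ≤ a) (hab : a ≤ b) (hb : b ≤ T) : g b - g a = ∫ t in a..b, h t := by
  rcases hab.eq_or_lt with rfl | hab
  · simp
  have hT : 0 < T := ha.trans_lt (hab.trans_le hb)
  have hhI : IntegrableOn h (Icc 0 T) := by rwa [integrableOn_Icc_iff_integrableOn_Ioo]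
  have hint : ∀ c ∈ Icc 0 T, ∀ d ∈ Icc 0 T, IntervalIntegrable h volume c d := fun c hc d hd =>
    (hhI.mono_set (uIcc_subset_Icc hc hd)).intervalIntegrable
  have h0 : (0 : ℝ) ∈ Icc 0 T := ⟨le_rfl, hT.le⟩
  have hcont : ContinuousOn (fun t => g t - ∫ s in (0 : ℝ)..t, h s) (Icc 0 T) :=
    hg.sub (intervalIntegral.continuousOn_primitive_interval
      (by rwa [uIcc_of_le hT.le]) |>.mono (by rw [uIcc_of_le hT.le]))
  have hmid : T / 2 ∈ Ioo 0 T := ⟨by linarith, by linarith⟩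
  have hconst : EqOn (fun t => g t - ∫ s in (0 : ℝ)..t, h s)
      (fun _ => g (T / 2) - ∫ s in (0 : ℝ)..(T / 2), h s) (Ioo 0 T) := by
    have key : ∀ c ∈ Ioo 0 T, ∀ d ∈ Ioo 0 T, c ≤ d →
        g d - ∫ s in (0 : ℝ)..d, h s = g c - ∫ s in (0 : ℝ)..c, h s := fun c hc d hd hcd => by
      have := sub_eq_integral_of_weakDeriv_Ioo hg hh hw hc.1 hcd hd.2
      rw [← intervalIntegral.integral_interval_sub_left
        (hint 0 h0 d (Ioo_subset_Icc_self hd)) (hint 0 h0 c (Ioo_subset_Icc_self hc))] at this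
      linear_combination this
    intro t ht
    rcases le_total t (T / 2) with h1 | h1
    · exact (key t ht _ hmid h1).symm
    · exact key _ hmid t ht h1
  -- Test functions see only the open interval; continuity carries the constant to both endpoints.
  have hall := hconst.of_subset_closure hcont continuousOn_const Ioo_subset_Icc_self
    (by rw [closure_Ioo hT.ne])
  have ha' : a ∈ Icc 0 T := ⟨ha, hab.le.trans hb⟩
  have hb' : b ∈ Icc 0 T := ⟨ha.trans hab.le, hb⟩
  rw [← intervalIntegral.integral_interval_sub_left (hint 0 h0 b hb') (hint 0 h0 a ha')]
  have e1 := hall ha'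
  have e2 := hall hb'
  simp only at e1 e2
  linear_combination e2 - e1

/-- Summing over a fine uniform subdivision telescopes both sides to `‖G T - G 0‖ ≤ ε (m T - m 0)`
for every `ε > 0`. This replaces differentiation of `G`. -/
theorem eq_of_forall_increment_le {E : Type*} [NormedAddCommGroup E] {T : ℝ} (hT : 0 < T)
    {G : ℝ → E} {m : ℝ → ℝ}
    (h : ∀ ε > 0, ∃ δ > 0, ∀ t t', 0 ≤ t → t ≤ t' → t' ≤ T → t' - t ≤ δ →
      ‖G t' - G t‖ ≤ ε * (m t' - m t)) : G T = G 0 := by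
  have key : ∀ ε > 0, ‖G T - G 0‖ ≤ ε * (m T - m 0) := by
    intro ε hε
    obtain ⟨δ, hδ, hd⟩ := h ε hε
    obtain ⟨N, hN⟩ := exists_nat_gt (T / δ)
    have hN0 : (0 : ℝ) < N := (div_pos hT hδ).trans hN
    have hstep : ∀ i ∈ Finset.range N, ‖G ((i + 1 : ℕ) * (T / N)) - G (i * (T / N))‖ ≤
        ε * (m ((i + 1 : ℕ) * (T / N)) - m (i * (T / N))) := fun i hi => by
      have hi' : ((i + 1 : ℕ) : ℝ) ≤ N := by exact_mod_cast Finset.mem_range.1 hi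
      have hTN : 0 < T / N := div_pos hT hN0
      refine hd _ _ (by positivity) ?_ ?_ ?_
      · gcongr; simp
      · calc ((i + 1 : ℕ) : ℝ) * (T / N) ≤ N * (T / N) := by gcongr
          _ = T := by field_simp
      · push_cast
        rw [← sub_mul, add_sub_cancel_left, one_mul, div_le_iff₀ hN0]
        rw [div_lt_iff₀ hδ] at hN
        linarith
    have e1 := Finset.sum_range_sub (fun i : ℕ => G (i * (T / N))) N
    have e2 := Finset.sum_range_sub (fun i : ℕ => m (i * (T / N))) N
    have e3 : (N : ℝ) * (T / N) = T := by field_simp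
    simp only [e3, Nat.cast_zero, zero_mul] at e1 e2
    rw [← e1, ← e2, Finset.mul_sum]
    exact (norm_sum_le _ _).trans (Finset.sum_le_sum hstep)
  rw [← sub_eq_zero, ← norm_le_zero_iff]
  by_contra! hpos
  have h1 := key 1 one_pos
  have hm : 0 < m T - m 0 := by linarith
  have h2 := key (‖G T - G 0‖ / (2 * (m T - m 0))) (by positivity)
  have h3 : ‖G T - G 0‖ / (2 * (m T - m 0)) * (m T - m 0) = ‖G T - G 0‖ / 2 := by field_simp
  linarith

end WeakDerivative

/-! ### The graph norm -/

namespace GraphDomain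

variable {𝕜 H : Type*} [RCLike 𝕜] [NormedAddCommGroup H] [InnerProductSpace 𝕜 H]
  {A : H →ₗ.[𝕜] H}

theorem incl_injective : Function.Injective (incl : GraphDomain A →ₗ[𝕜] H) :=
  Subtype.val_injective

theorem norm_sq_eq (x : GraphDomain A) : ‖x‖ ^ 2 = ‖incl x‖ ^ 2 + ‖op x‖ ^ 2 := by
  rw [← inner_self_eq_norm_sq (𝕜 := 𝕜) x, ← inner_self_eq_norm_sq (𝕜 := 𝕜) (incl x),
    ← inner_self_eq_norm_sq (𝕜 := 𝕜) (op x), ← _root_.map_add]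
  rfl

theorem norm_incl_le (x : GraphDomain A) : ‖incl x‖ ≤ ‖x‖ :=
  le_of_sq_le_sq (by rw [norm_sq_eq]; nlinarith [sq_nonneg ‖op x‖]) (norm_nonneg _)

theorem norm_op_le (x : GraphDomain A) : ‖op x‖ ≤ ‖x‖ :=
  le_of_sq_le_sq (by rw [norm_sq_eq]; nlinarith [sq_nonneg ‖incl x‖]) (norm_nonneg _)

theorem norm_le_add (x : GraphDomain A) : ‖x‖ ≤ ‖incl x‖ + ‖op x‖ :=
  le_of_sq_le_sq (by rw [norm_sq_eq]; nlinarith [norm_nonneg (incl x), norm_nonneg (op x)])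
    (by positivity)

theorem continuous_incl : Continuous (incl : GraphDomain A →ₗ[𝕜] H) :=
  (incl.mkContinuous 1 fun x => by simpa using norm_incl_le x).continuous

theorem continuous_op : Continuous (op : GraphDomain A →ₗ[𝕜] H) :=
  (op.mkContinuous 1 fun x => by simpa using norm_op_le x).continuous

theorem tendsto_of_incl_op {α : Type*} {l : Filter α} {f : α → GraphDomain A} {x : GraphDomain A}
    (h1 : Tendsto (fun a => incl (f a)) l (𝓝 (incl x)))
    (h2 : Tendsto (fun a => op (f a)) l (𝓝 (op x))) : Tendsto f l (𝓝 x) := by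
  rw [tendsto_iff_norm_sub_tendsto_zero] at h1 h2 ⊢
  refine squeeze_zero (fun _ => norm_nonneg _) (fun a => ?_) (by simpa using h1.add h2)
  have := norm_le_add (f a - x)
  rwa [_root_.map_sub, _root_.map_sub] at this

end GraphDomain

/-! ### Orbits in `D(A*)` and the duality formula for weak solutions -/

namespace C0Group

variable {𝕜 H : Type*} [RCLike 𝕜] [NormedAddCommGroup H] [InnerProductSpace 𝕜 H] [CompleteSpace H]

section Orbit

variable [NormedSpace ℝ H] [IsScalarTower ℝ 𝕜 H]

theorem op_adjOrbit (S : C0Group 𝕜 H) (t : ℝ) (z : S.AdjDomain) :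
    GraphDomain.op (S.adjOrbit t z) = S.adjGroup.toFun t (GraphDomain.op z) :=
  (S.hasGenerator_adjGroup (S.adjOrbit t z)).unique ((S.hasGenerator_adjGroup z).map t)

theorem adjOrbit_zero (S : C0Group 𝕜 H) (z : S.AdjDomain) : S.adjOrbit 0 z = z :=
  GraphDomain.incl_injective (by rw [incl_adjOrbit, toFun_zero_apply])

theorem adjOrbit_add (S : C0Group 𝕜 H) (s t : ℝ) (z : S.AdjDomain) :
    S.adjOrbit (s + t) z = S.adjOrbit s (S.adjOrbit t z) :=
  GraphDomain.incl_injective (by simp only [incl_adjOrbit, toFun_add_apply])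

theorem adjOrbit_map_add (S : C0Group 𝕜 H) (t : ℝ) (x y : S.AdjDomain) :
    S.adjOrbit t (x + y) = S.adjOrbit t x + S.adjOrbit t y :=
  GraphDomain.incl_injective (by simp only [incl_adjOrbit, _root_.map_add])

theorem adjOrbit_map_smul (S : C0Group 𝕜 H) (t : ℝ) (c : 𝕜) (x : S.AdjDomain) :
    S.adjOrbit t (c • x) = c • S.adjOrbit t x :=
  GraphDomain.incl_injective (by simp only [incl_adjOrbit, _root_.map_smul])

theorem continuous_adjOrbit (S : C0Group 𝕜 H) (z : S.AdjDomain) :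
    Continuous fun t => S.adjOrbit t z := by
  rw [continuous_iff_continuousAt]
  intro t
  refine GraphDomain.tendsto_of_incl_op ?_ ?_
  · simp only [incl_adjOrbit]
    exact (S.adjGroup.continuous_orbit _).tendsto t
  · simp only [op_adjOrbit]
    exact (S.adjGroup.continuous_orbit _).tendsto t

/-- For `z ∈ D((A*)²)` the difference quotients converge in the graph norm, since both `z` and `A*
z` have differentiable orbits in `H`. As `B*` is bounded only for that norm, this is what makes `B*
e^{-sA*} z` differentiable. -/
theorem tendsto_slope_adjOrbit (S : C0Group 𝕜 H) {z w : S.AdjDomain}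
    (h : GraphDomain.op z = GraphDomain.incl w) :
    Tendsto (fun t : ℝ => (t : 𝕜)⁻¹ • (S.adjOrbit t z - z)) (𝓝[≠] 0) (𝓝 w) := by
  refine GraphDomain.tendsto_of_incl_op ?_ ?_
  · have := S.hasGenerator_adjGroup z
    rw [h] at this
    refine this.congr fun t => ?_
    rw [_root_.map_smul, _root_.map_sub, incl_adjOrbit]
  · have := S.hasGenerator_adjGroup w
    rw [← h] at this
    refine this.congr fun t => ?_
    rw [_root_.map_smul, _root_.map_sub, op_adjOrbit]

/-- The elements of `D(A*)` whose image under `A*` lies in `D(A*)` are dense for the graph norm. -/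
theorem dense_adjDomain_sq (S : C0Group 𝕜 H) :
    Dense {z : S.AdjDomain | ∃ w : S.AdjDomain, GraphDomain.op z = GraphDomain.incl w} := by
  intro z
  have h1 : ∀ h : ℝ, ∃ x : S.AdjDomain, GraphDomain.incl x =
        (h : 𝕜)⁻¹ • ∫ s in (0 : ℝ)..h, S.adjGroup.toFun s (GraphDomain.incl z) ∧
      GraphDomain.op x =
        (h : 𝕜)⁻¹ • ∫ s in (0 : ℝ)..h, S.adjGroup.toFun s (GraphDomain.op z) := fun h => by
    refine HasGenerator.exists_adjDomain (HasGenerator.smul _ ?_)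
    rw [(S.hasGenerator_adjGroup z).integral_eq h]
    exact S.adjGroup.hasGenerator_integral _ h
  choose x hx1 hx2 using h1
  refine mem_closure_of_tendsto (f := x) (b := 𝓝[≠] (0 : ℝ))
    (GraphDomain.tendsto_of_incl_op ?_ ?_) (Eventually.of_forall fun h => ?_)
  · simp only [hx1]
    exact S.adjGroup.tendsto_average_orbit _
  · simp only [hx2]
    exact S.adjGroup.tendsto_average_orbit _
  -- `A* x` is an average of the orbit of `A* z`, and such averages lie in `D(A*)`.
  · obtain ⟨w, hw, -⟩ := HasGenerator.exists_adjDomain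
      ((S.adjGroup.hasGenerator_integral (GraphDomain.op z) h).smul ((h : 𝕜)⁻¹))
    exact ⟨w, (hx2 h).trans hw.symm⟩

variable {U : Type*} [NormedAddCommGroup U] [InnerProductSpace 𝕜 U] [CompleteSpace U]

theorem continuous_bStar_adjOrbit (S : C0Group 𝕜 H) (B : U →L[𝕜] S.AdjDual) (z : S.AdjDomain) :
    Continuous fun s => S.bStar B (S.adjOrbit (-s) z) :=
  (S.bStar B).continuous.comp ((S.continuous_adjOrbit z).comp continuous_neg)

theorem hasDerivAt_bStar_adjOrbit [NormedSpace ℝ U] [IsScalarTower ℝ 𝕜 U] (S : C0Group 𝕜 H)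
    (B : U →L[𝕜] S.AdjDual) {z w : S.AdjDomain} (h : GraphDomain.op z = GraphDomain.incl w)
    (s : ℝ) :
    HasDerivAt (fun s => S.bStar B (S.adjOrbit (-s) z)) (-S.bStar B (S.adjOrbit (-s) w)) s := by
  have h1 : HasDerivAt (fun s => S.bStar B (S.adjOrbit s z)) (S.bStar B (S.adjOrbit (-s) w))
      (-s) := by
    rw [hasDerivAt_iff_tendsto_slope_zero]
    have h2 := S.tendsto_slope_adjOrbit (z := S.adjOrbit (-s) z) (w := S.adjOrbit (-s) w)
      (by rw [op_adjOrbit, incl_adjOrbit, h])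
    refine (((S.bStar B).continuous.tendsto _).comp h2).congr fun t => ?_
    simp only [Function.comp_apply]
    rw [_root_.map_smul, _root_.map_sub, ← adjOrbit_add, add_comm, ← RCLike.ofReal_inv,
      RCLike.real_smul_eq_coe_smul (K := 𝕜)]
  simpa [Function.comp_def] using HasDerivAt.scomp (h := fun s : ℝ => -s) s h1 (hasDerivAt_neg s)

/-- The duality (mild solution) formula satisfied by every weak solution. -/
theorem IsWeakSolution.inner_sub_eq {S : C0Group 𝕜 H} {B : U →L[𝕜] S.AdjDual} {T : ℝ}
    (hT : 0 < T) {u : ℝ → U} (hu : MemLp u 2 (volume.restrict (Ioo 0 T))) {y₀ : H} {y : ℝ → H}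
    (hy : S.IsWeakSolution B T u y₀ y) (z : S.AdjDomain) :
    ⟪GraphDomain.incl (S.adjOrbit (-T) z), y T⟫_𝕜 - ⟪GraphDomain.incl z, y₀⟫_𝕜 =
      ∫ s in Ioo 0 T, ⟪S.bStar B (S.adjOrbit (-s) z), u s⟫_𝕜 := by
  obtain ⟨hyc, hy0, hyw⟩ := hy
  have hui : IntegrableOn u (Ioo 0 T) := hu.integrable one_le_two
  have huI : IntegrableOn u (Icc 0 T) := by rwa [integrableOn_Icc_iff_integrableOn_Ioo]
  let k : ℝ → H := fun t => GraphDomain.incl (S.adjOrbit (-t) z)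
  let k1 : ℝ → H := fun t => GraphDomain.op (S.adjOrbit (-t) z)
  let kb : ℝ → U := fun t => S.bStar B (S.adjOrbit (-t) z)
  have hk1c : Continuous k1 := by
    refine GraphDomain.continuous_op.comp ((S.continuous_adjOrbit z).comp continuous_neg)
  have hkbc : Continuous kb := S.continuous_bStar_adjOrbit B z
  have hkd : ∀ t, HasDerivAt k (-k1 t) t := fun t => by
    have h1 := (S.hasGenerator_adjGroup z).hasDerivAt (-t)
    have h2 := HasDerivAt.scomp (h := fun s : ℝ => -s) t h1 (hasDerivAt_neg t)
    simpa [Function.comp_def, k, k1, incl_adjOrbit, op_adjOrbit] using h2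
  -- integrability of the pairings on subintervals
  have hint1 : ∀ v : H, ∀ a b, 0 ≤ a → a ≤ b → b ≤ T →
      IntervalIntegrable (fun r => ⟪v, y r⟫_𝕜) volume a b := fun v a b ha hab hb => by
    refine ContinuousOn.intervalIntegrable ?_
    rw [uIcc_of_le hab]
    exact (continuousOn_const.inner hyc).mono (Icc_subset_Icc ha hb)
  have hint2 : ∀ f : ℝ → U, Continuous f → IntegrableOn (fun r => ⟪f r, u r⟫_𝕜) (Icc 0 T) := by
    intro f hf
    obtain ⟨C, hC⟩ := isCompact_Icc.exists_bound_of_continuousOn (s := Icc 0 T) hf.continuousOn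
    refine Integrable.mono' (huI.norm.const_mul C)
      (hf.aestronglyMeasurable.inner huI.aestronglyMeasurable) ?_
    refine (ae_restrict_mem measurableSet_Icc).mono fun r hr => ?_
    exact (norm_inner_le_norm _ _).trans (by gcongr; exact hC r hr)
  have hint2' : ∀ f : ℝ → U, Continuous f → ∀ a b, 0 ≤ a → a ≤ b → b ≤ T →
      IntervalIntegrable (fun r => ⟪f r, u r⟫_𝕜) volume a b := fun f hf a b ha hab hb =>
    ((hint2 f hf).mono_set
      (uIcc_subset_Icc ⟨ha, hab.trans hb⟩ ⟨ha.trans hab, hb⟩)).intervalIntegrable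
  have hnorm : ∀ a b, 0 ≤ a → a ≤ b → b ≤ T →
      IntervalIntegrable (fun r => 1 + ‖u r‖) volume a b := fun a b ha hab hb =>
    intervalIntegrable_const.add (IntegrableOn.mono_set (f := fun r => ‖u r‖) huI.norm
      (uIcc_subset_Icc ⟨ha, hab.trans hb⟩ ⟨ha.trans hab, hb⟩)).intervalIntegrable
  -- the weak formulation, integrated
  have hweak : ∀ w : S.AdjDomain, ∀ a b, 0 ≤ a → a ≤ b → b ≤ T →
      ⟪GraphDomain.incl w, y b⟫_𝕜 - ⟪GraphDomain.incl w, y a⟫_𝕜 =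
        ∫ r in a..b, (⟪GraphDomain.op w, y r⟫_𝕜 + ⟪S.bStar B w, u r⟫_𝕜) :=
    fun w a b ha hab hb => sub_eq_integral_of_weakDeriv (continuousOn_const.inner hyc)
      (((continuousOn_const.inner hyc).integrableOn_Icc.mono_set Ioo_subset_Icc_self).add
        ((hint2 _ continuous_const).mono_set Ioo_subset_Icc_self)) (hyw w) ha hab hb
  -- The claim is that `G` is constant. The product rule is unavailable, since `y` is only weakly
  -- differentiable; over a short interval `y` moves first, with `k t'` frozen (`e1`), then `k`
  -- moves, with `y t` frozen (`e2`). The `A*` terms cancel up to a modulus of continuity.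
  let G : ℝ → 𝕜 := fun t => ⟪k t, y t⟫_𝕜 - ∫ r in (0 : ℝ)..t, ⟪kb r, u r⟫_𝕜
  -- The summand `1` absorbs the error in the `A*` terms and `‖u r‖` the error in the control term.
  let m : ℝ → ℝ := fun t => ∫ r in (0 : ℝ)..t, (1 + ‖u r‖)
  have hG : G T = G 0 := by
    refine eq_of_forall_increment_le (m := m) hT fun ε hε => ?_
    have huc1 : UniformContinuousOn (fun p : ℝ × ℝ => ⟪k1 p.1, y p.2⟫_𝕜) (Icc 0 T ×ˢ Icc 0 T) :=
      (isCompact_Icc.prod isCompact_Icc).uniformContinuousOn_of_continuous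
        (ContinuousOn.inner (hk1c.comp continuous_fst).continuousOn
          (hyc.comp continuousOn_snd fun p hp => hp.2))
    have huc2 : UniformContinuousOn kb (Icc 0 T) :=
      isCompact_Icc.uniformContinuousOn_of_continuous hkbc.continuousOn
    obtain ⟨δ1, hδ1, hd1⟩ := Metric.uniformContinuousOn_iff_le.1 huc1 ε hε
    obtain ⟨δ2, hδ2, hd2⟩ := Metric.uniformContinuousOn_iff_le.1 huc2 ε hε
    refine ⟨min δ1 δ2, lt_min hδ1 hδ2, fun t t' ht htt' ht' hδ => ?_⟩
    have hti : t ∈ Icc 0 T := ⟨ht, htt'.trans ht'⟩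
    have hti' : t' ∈ Icc 0 T := ⟨ht.trans htt', ht'⟩
    have e1 : ⟪k t', y t'⟫_𝕜 - ⟪k t', y t⟫_𝕜 = ∫ r in t..t', (⟪k1 t', y r⟫_𝕜 + ⟪kb t', u r⟫_𝕜) :=
      hweak _ t t' ht htt' ht'
    have hc2 : Continuous fun r => ⟪k1 r, y t⟫_𝕜 := hk1c.inner continuous_const
    have e2 : ⟪k t', y t⟫_𝕜 - ⟪k t, y t⟫_𝕜 = -∫ r in t..t', ⟪k1 r, y t⟫_𝕜 := by
      rw [← intervalIntegral.integral_neg]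
      refine (intervalIntegral.integral_eq_sub_of_hasDerivAt (f := fun r => ⟪k r, y t⟫_𝕜)
        (fun r _ => ?_) (hc2.neg.intervalIntegrable _ _)).symm
      simpa using (hkd r).inner 𝕜 (hasDerivAt_const r (y t))
    have e3 : (∫ r in (0 : ℝ)..t', ⟪kb r, u r⟫_𝕜) - ∫ r in (0 : ℝ)..t, ⟪kb r, u r⟫_𝕜 =
        ∫ r in t..t', ⟪kb r, u r⟫_𝕜 :=
      intervalIntegral.integral_interval_sub_left (hint2' kb hkbc 0 t' le_rfl hti'.1 ht')
        (hint2' kb hkbc 0 t le_rfl ht hti.2)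
    have e4 : m t' - m t = ∫ r in t..t', (1 + ‖u r‖) :=
      intervalIntegral.integral_interval_sub_left (hnorm 0 t' le_rfl hti'.1 ht')
        (hnorm 0 t le_rfl ht hti.2)
    have e5 : G t' - G t = ∫ r in t..t', (⟪k1 t', y r⟫_𝕜 + ⟪kb t', u r⟫_𝕜 - ⟪k1 r, y t⟫_𝕜
        - ⟪kb r, u r⟫_𝕜) := by
      have i1 := (hint1 (k1 t') t t' ht htt' ht').add 
        (hint2' _ (continuous_const (y := kb t')) t t' ht htt' ht')
      rw [intervalIntegral.integral_sub (i1.sub (hc2.intervalIntegrable _ _))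
        (hint2' kb hkbc t t' ht htt' ht'),
        intervalIntegral.integral_sub i1 (hc2.intervalIntegrable _ _), ← e1, ← e3]
      simp only [G]
      linear_combination e2
    rw [e5, e4, ← intervalIntegral.integral_const_mul]
    refine intervalIntegral.norm_integral_le_of_norm_le htt'
      (Eventually.of_forall fun r hr => ?_) ((hnorm t t' ht htt' ht').const_mul ε)
    have hri : r ∈ Icc 0 T := ⟨ht.trans hr.1.le, hr.2.trans ht'⟩
    have b1 : ‖⟪k1 t', y r⟫_𝕜 - ⟪k1 r, y t⟫_𝕜‖ ≤ ε := by
      rw [← dist_eq_norm]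
      refine hd1 (t', r) ⟨hti', hri⟩ (r, t) ⟨hri, hti⟩ ?_
      refine le_trans ?_ (hδ.trans (min_le_left _ _))
      rw [Prod.dist_eq, max_le_iff, Real.dist_eq, Real.dist_eq, abs_of_nonneg (by linarith [hr.2]),
        abs_of_nonneg (by linarith [hr.1])]
      constructor <;> linarith [hr.1, hr.2]
    have b2 : ‖⟪kb t', u r⟫_𝕜 - ⟪kb r, u r⟫_𝕜‖ ≤ ε * ‖u r‖ := by
      rw [← inner_sub_left]
      refine (norm_inner_le_norm _ _).trans ?_
      gcongr
      rw [← dist_eq_norm]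
      refine hd2 t' hti' r hri (le_trans ?_ (hδ.trans (min_le_right _ _)))
      rw [Real.dist_eq, abs_of_nonneg (by linarith [hr.2])]
      linarith [hr.1]
    have : ⟪k1 t', y r⟫_𝕜 + ⟪kb t', u r⟫_𝕜 - ⟪k1 r, y t⟫_𝕜 - ⟪kb r, u r⟫_𝕜 =
        (⟪k1 t', y r⟫_𝕜 - ⟪k1 r, y t⟫_𝕜) + (⟪kb t', u r⟫_𝕜 - ⟪kb r, u r⟫_𝕜) := by ring
    rw [this]
    refine (norm_add_le _ _).trans ?_
    linarith
  have hk0 : k 0 = GraphDomain.incl z := by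
    simp only [k, neg_zero, adjOrbit_zero]
  simp only [G, intervalIntegral.integral_same, sub_zero, hk0, hy0] at hG
  rw [← integral_Ioc_eq_integral_Ioo, ← intervalIntegral.integral_of_le hT.le]
  linear_combination hG

end Orbit

end C0Group

/-! ### Uniform boundedness, the output map and observability -/

/-- A form of the uniform boundedness principle: a family of vectors whose inner products with any
fixed vector are controlled by `p` is controlled by `p`. -/
theorem exists_norm_le_mul_of_forall_inner_le {𝕜 E ι : Type*} [RCLike 𝕜] [NormedAddCommGroup E]
    [InnerProductSpace 𝕜 E] [CompleteSpace E] (v : ι → E) (p : ι → ℝ) (hp : ∀ i, 0 ≤ p i)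
    (h : ∀ y : E, ∃ C : ℝ, ∀ i, ‖⟪v i, y⟫_𝕜‖ ≤ C * p i) :
    ∃ C : ℝ, 0 < C ∧ ∀ i, ‖v i‖ ≤ C * p i := by
  obtain ⟨C, hC⟩ := banach_steinhaus (g := fun i => (((p i)⁻¹ : ℝ) : 𝕜) • innerSL 𝕜 (v i))
    fun y => by
      obtain ⟨C, hC⟩ := h y
      refine ⟨max C 0, fun i => ?_⟩
      rw [smul_apply, innerSL_apply_apply, norm_smul, RCLike.norm_ofReal,
        abs_of_nonneg (inv_nonneg.2 (hp i))]
      rcases (hp i).eq_or_lt with h0 | h0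
      · rw [← h0]; simp
      · rw [inv_mul_le_iff₀ h0, mul_comm]
        exact (hC i).trans (by gcongr; exact le_max_left _ _)
  refine ⟨max C 1, by positivity, fun i => ?_⟩
  rcases (hp i).eq_or_lt with h0 | h0
  -- The normalised functional vanishes when `p i = 0` and carries no information; testing `v i`
  -- against itself gives `v i = 0`.
  · obtain ⟨C', hC'⟩ := h (v i)
    have := hC' i
    rw [← h0, mul_zero, norm_le_zero_iff, inner_self_eq_zero] at this
    rw [← h0, this]; simp
  · have := hC i
    rw [norm_smul, RCLike.norm_ofReal, abs_of_nonneg (inv_nonneg.2 (hp i)), innerSL_apply_norm,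
      inv_mul_le_iff₀ h0, mul_comm] at this
    exact this.trans (by gcongr; exact le_max_left _ _)

namespace C0Group

section Output

variable {𝕜 H U : Type*} [RCLike 𝕜] [NormedAddCommGroup H] [InnerProductSpace 𝕜 H]
  [CompleteSpace H] [NormedAddCommGroup U] [InnerProductSpace 𝕜 U] [CompleteSpace U]
  [NormedSpace ℝ H] [IsScalarTower ℝ 𝕜 H]

theorem memLp_bStar_adjOrbit (S : C0Group 𝕜 H) (B : U →L[𝕜] S.AdjDual) (τ : ℝ) (z : S.AdjDomain) :
    MemLp (fun s => S.bStar B (S.adjOrbit (-s) z)) 2 (volume.restrict (Ioo 0 τ)) := by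
  have hc := S.continuous_bStar_adjOrbit B z
  obtain ⟨C, hC⟩ := isCompact_Icc.exists_bound_of_continuousOn (s := Icc 0 τ) hc.continuousOn
  refine MemLp.of_bound hc.aestronglyMeasurable C ?_
  exact (ae_restrict_mem measurableSet_Ioo).mono fun s hs => hC s (Ioo_subset_Icc_self hs)

/-- The map `z ↦ (s ↦ B* e^{-sA*} z)` from `D(A*)` to `L²((0,τ); U)`. -/
noncomputable def outputLp (S : C0Group 𝕜 H) (B : U →L[𝕜] S.AdjDual) (τ : ℝ) :
    S.AdjDomain →ₗ[𝕜] Lp U 2 (volume.restrict (Ioo 0 τ)) where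
  toFun z := (S.memLp_bStar_adjOrbit B τ z).toLp
  map_add' x y := by
    rw [← MemLp.toLp_add]
    exact MemLp.toLp_congr _ _ (Eventually.of_forall fun s => by
      simp only [adjOrbit_map_add, _root_.map_add, Pi.add_apply])
  map_smul' c x := by
    rw [RingHom.id_apply, ← MemLp.toLp_const_smul]
    exact MemLp.toLp_congr _ _ (Eventually.of_forall fun s => by
      simp only [adjOrbit_map_smul, _root_.map_smul, Pi.smul_apply])

theorem outputLp_coeFn (S : C0Group 𝕜 H) (B : U →L[𝕜] S.AdjDual) (τ : ℝ) (z : S.AdjDomain) :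
    S.outputLp B τ z =ᵐ[volume.restrict (Ioo 0 τ)] fun s => S.bStar B (S.adjOrbit (-s) z) :=
  (S.memLp_bStar_adjOrbit B τ z).coeFn_toLp

theorem inner_outputLp (S : C0Group 𝕜 H) (B : U →L[𝕜] S.AdjDual) (τ : ℝ) (z : S.AdjDomain)
    (u : Lp U 2 (volume.restrict (Ioo 0 τ))) :
    ⟪S.outputLp B τ z, u⟫_𝕜 = ∫ s in Ioo 0 τ, ⟪S.bStar B (S.adjOrbit (-s) z), u s⟫_𝕜 := by
  rw [L2.inner_def]
  refine integral_congr_ae ((S.outputLp_coeFn B τ z).mono fun s hs => ?_)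
  simp only [hs]

theorem norm_outputLp_sq (S : C0Group 𝕜 H) (B : U →L[𝕜] S.AdjDual) (τ : ℝ) (z : S.AdjDomain) :
    ‖S.outputLp B τ z‖ ^ 2 = ∫ s in Ioo 0 τ, ‖S.bStar B (S.adjOrbit (-s) z)‖ ^ 2 := by
  have h : ∫ s in Ioo 0 τ, ⟪S.bStar B (S.adjOrbit (-s) z), S.outputLp B τ z s⟫_𝕜 =
      ∫ s in Ioo 0 τ, ((‖S.bStar B (S.adjOrbit (-s) z)‖ ^ 2 : ℝ) : 𝕜) := by
    refine integral_congr_ae ((S.outputLp_coeFn B τ z).mono fun s hs => ?_)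
    simp only [hs]
    rw [inner_self_eq_norm_sq_to_K, RCLike.ofReal_pow]
  rw [← inner_self_eq_norm_sq (𝕜 := 𝕜), inner_outputLp, h, integral_ofReal, RCLike.ofReal_re]

/-- Admissibility bounds the output map by the norm of `H`. -/
theorem Admissible.exists_norm_outputLp_le {S : C0Group 𝕜 H} {B : U →L[𝕜] S.AdjDual}
    (hB : S.Admissible B) {τ : ℝ} (hτ : 0 < τ) :
    ∃ C : ℝ, 0 < C ∧ ∀ z : S.AdjDomain, ‖S.outputLp B τ z‖ ≤ C * ‖GraphDomain.incl z‖ := by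
  refine exists_norm_le_mul_of_forall_inner_le (𝕜 := 𝕜) _ _ (fun _ => norm_nonneg _) fun u => ?_
  obtain ⟨φ, -, hφ⟩ := hB τ hτ u (Lp.memLp u)
  refine ⟨‖S.adjGroup.toFun (-τ)‖ * ‖φ τ‖, fun z => ?_⟩
  -- Testing the final state against `e^{-τA*} z` turns `S(τ - s)*` into `e^{-sA*}`; the group
  -- property permits negative times.
  have h1 : ⟪S.outputLp B τ z, u⟫_𝕜 = ⟪GraphDomain.incl (S.adjOrbit (-τ) z), φ τ⟫_𝕜 := by
    rw [hφ τ ⟨hτ.le, le_rfl⟩, inner_outputLp, intervalIntegral.integral_of_le hτ.le,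
      integral_Ioc_eq_integral_Ioo]
    refine integral_congr_ae (Eventually.of_forall fun s => ?_)
    simp only
    rw [inner_bStar, ← adjOrbit_add, show τ - s + -τ = -s by ring]
  rw [h1, incl_adjOrbit]
  calc _ ≤ _ := norm_inner_le_norm _ _
    _ ≤ (‖S.adjGroup.toFun (-τ)‖ * ‖GraphDomain.incl z‖) * ‖φ τ‖ := by
      gcongr; exact ContinuousLinearMap.le_opNorm _ _
    _ = _ := by ring

/-- Exact controllability in time `T` yields the observability inequality. -/
theorem ExactlyControllable.exists_norm_incl_le {S : C0Group 𝕜 H} {B : U →L[𝕜] S.AdjDual}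
    {T : ℝ} (hT : 0 < T) (hc : S.ExactlyControllable B T) :
    ∃ C : ℝ, 0 < C ∧ ∀ z : S.AdjDomain, ‖GraphDomain.incl z‖ ≤ C * ‖S.outputLp B T z‖ := by
  refine exists_norm_le_mul_of_forall_inner_le (𝕜 := 𝕜) _ _ (fun _ => norm_nonneg _) fun y₀ => ?_
  -- With target `0`, the duality formula retains only `-⟪z, y₀⟫` on its left side.
  obtain ⟨u, hu, y, hy, hyT⟩ := hc y₀ 0
  refine ⟨‖hu.toLp‖, fun z => ?_⟩
  have h1 := hy.inner_sub_eq hT hu z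
  rw [hyT, inner_zero_right, zero_sub] at h1
  have h2 : ⟪S.outputLp B T z, hu.toLp⟫_𝕜 =
      ∫ s in Ioo 0 T, ⟪S.bStar B (S.adjOrbit (-s) z), u s⟫_𝕜 := by
    rw [inner_outputLp]
    refine integral_congr_ae (hu.coeFn_toLp.mono fun s hs => ?_)
    simp only [hs]
  rw [← norm_neg, h1, ← h2, mul_comm]
  exact norm_inner_le_norm _ _

theorem Admissible.exists_unique_outputMap {S : C0Group 𝕜 H} {B : U →L[𝕜] S.AdjDual}
    (hB : S.Admissible B) {τ : ℝ} (hτ : 0 < τ) :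
    ∃ Ψ : H →L[𝕜] Lp U 2 (volume.restrict (Ioo 0 τ)),
      ∀ Ψ', S.IsOutputMap B τ Ψ' ↔ Ψ' = Ψ := by
  obtain ⟨C, -, hC⟩ := hB.exists_norm_outputLp_le hτ
  have hΨ := LinearMap.extendOfNorm_eq S.dense_range_incl ⟨C, hC⟩
  refine ⟨(S.outputLp B τ).extendOfNorm GraphDomain.incl, fun Ψ' => ⟨fun h => ?_, ?_⟩⟩
  · refine ContinuousLinearMap.ext fun x => ?_
    refine congrFun (S.dense_range_incl.equalizer Ψ'.continuous
      (ContinuousLinearMap.continuous _) (funext fun z => ?_)) x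
    simp only [Function.comp_apply]
    rw [hΨ]
    exact Lp.ext ((h z).trans (S.outputLp_coeFn B τ z).symm)
  · rintro rfl z
    rw [hΨ]
    exact S.outputLp_coeFn B τ z

end Output

/-! ### Bounded operators representing the weighted forms -/

section WeightedForm

variable {𝕜 H U : Type*} [RCLike 𝕜] [NormedAddCommGroup H] [InnerProductSpace 𝕜 H]
  [NormedAddCommGroup U] [InnerProductSpace 𝕜 U]

/-- With this operator the weighted form becomes the `L²` inner product `⟪N Ψ x, Ψ y⟫`, which yields
both its integrability and the representing operator `Ψ* N Ψ`. -/
theorem exists_mul_operator {α : Type*} [MeasurableSpace α] {μ : Measure α} (W : U →L[𝕜] U)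
    {w : α → ℝ} (hw : AEStronglyMeasurable w μ) {C : ℝ} (hC : ∀ᵐ s ∂μ, |w s| ≤ C) :
    ∃ N : Lp U 2 μ →L[𝕜] Lp U 2 μ, ∀ f, N f =ᵐ[μ] fun s => (w s : 𝕜) • W (f s) := by
  have hb : ∀ f : Lp U 2 μ, ∀ᵐ s ∂μ, ‖(w s : 𝕜) • W (f s)‖ ≤ (C * ‖W‖) * ‖f s‖ := fun f =>
    hC.mono fun s hs => by
      rw [norm_smul, RCLike.norm_ofReal, mul_assoc]
      have hC0 : 0 ≤ C := (abs_nonneg _).trans hs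
      gcongr
      exact W.le_opNorm _
  have hm : ∀ f : Lp U 2 μ, MemLp (fun s => (w s : 𝕜) • W (f s)) 2 μ := fun f =>
    (Lp.memLp f).of_le_mul ((RCLike.continuous_ofReal.comp_aestronglyMeasurable hw).smul
      (W.continuous.comp_aestronglyMeasurable (Lp.aestronglyMeasurable f))) (hb f)
  refine ⟨LinearMap.mkContinuous
    { toFun := fun f => MemLp.toLp (fun s => (w s : 𝕜) • W (f s)) (hm f)
      map_add' := fun f g => ?_
      map_smul' := fun c f => ?_ } (C * ‖W‖) fun f => ?_, fun f => (hm f).coeFn_toLp⟩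
  · rw [← MemLp.toLp_add]
    refine MemLp.toLp_congr _ _ ((Lp.coeFn_add f g).mono fun s hs => ?_)
    simp only [hs, Pi.add_apply, _root_.map_add, smul_add]
  · rw [RingHom.id_apply, ← MemLp.toLp_const_smul]
    refine MemLp.toLp_congr _ _ ((Lp.coeFn_smul c f).mono fun s hs => ?_)
    simp only [hs, Pi.smul_apply, _root_.map_smul, smul_comm c]
  · refine Lp.norm_le_mul_norm_of_ae_le_mul ?_
    filter_upwards [(hm f).coeFn_toLp, hb f] with s h1 h2
    exact (congrArg norm h1).trans_le h2

variable {τ : ℝ} (Ψ : H →L[𝕜] Lp U 2 (volume.restrict (Ioo 0 τ))) {W : U →L[𝕜] U} {w : ℝ → ℝ}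

theorem integrable_weightedForm (W : U →L[𝕜] U)
    (hw : AEStronglyMeasurable w (volume.restrict (Ioo 0 τ))) {C : ℝ}
    (hC : ∀ s ∈ Ioo 0 τ, |w s| ≤ C) (x y : H) :
    Integrable (fun s => (w s : 𝕜) * ⟪W (Ψ x s), Ψ y s⟫_𝕜) (volume.restrict (Ioo 0 τ)) := by
  obtain ⟨N, hN⟩ := exists_mul_operator W hw
    ((ae_restrict_mem measurableSet_Ioo).mono hC)
  refine (L2.integrable_inner (𝕜 := 𝕜) (N (Ψ x)) (Ψ y)).congr ((hN (Ψ x)).mono fun s hs => ?_)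
  simp only [hs, inner_smul_left, RCLike.conj_ofReal]

theorem exists_operator_weightedForm [CompleteSpace H] [CompleteSpace U] (W : U →L[𝕜] U)
    (hw : AEStronglyMeasurable w (volume.restrict (Ioo 0 τ))) {C : ℝ}
    (hC : ∀ s ∈ Ioo 0 τ, |w s| ≤ C) :
    ∃ M : H →L[𝕜] H, ∀ x y, ⟪M x, y⟫_𝕜 = weightedForm Ψ W w x y := by
  obtain ⟨N, hN⟩ := exists_mul_operator W hw
    ((ae_restrict_mem measurableSet_Ioo).mono hC)
  refine ⟨(ContinuousLinearMap.adjoint Ψ).comp (N.comp Ψ), fun x y => ?_⟩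
  rw [ContinuousLinearMap.comp_apply, ContinuousLinearMap.adjoint_inner_left, L2.inner_def]
  refine integral_congr_ae ((hN (Ψ x)).mono fun s hs => ?_)
  simp only [ContinuousLinearMap.comp_apply, hs, inner_smul_left, RCLike.conj_ofReal]

theorem weightedForm_symm [CompleteSpace H] [CompleteSpace U] (hW : W.IsSymmetric) (x y : H) :
    weightedForm Ψ W w x y = starRingEnd 𝕜 (weightedForm Ψ W w y x) := by
  rw [weightedForm, weightedForm, ← integral_conj]
  refine integral_congr_ae (Eventually.of_forall fun s => ?_)
  simp only [_root_.map_mul, RCLike.conj_ofReal, inner_conj_symm]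
  congr 1
  exact hW _ _

theorem re_weightedForm [CompleteSpace H] [CompleteSpace U]
    (hw : AEStronglyMeasurable w (volume.restrict (Ioo 0 τ))) {C : ℝ}
    (hC : ∀ s ∈ Ioo 0 τ, |w s| ≤ C) (x y : H) :
    RCLike.re (weightedForm Ψ W w x y) =
      ∫ s in Ioo 0 τ, w s * RCLike.re ⟪W (Ψ x s), Ψ y s⟫_𝕜 := by
  rw [weightedForm, ← integral_re (integrable_weightedForm Ψ W hw hC x y)]
  simp only [RCLike.re_ofReal_mul]

end WeightedForm

end C0Group

/-! ### Integration by parts against a Lipschitz weight -/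

section Weights

/-- Lipschitz and `C¹` functions are absolutely continuous, so integration by parts holds although
`ρ` need only be differentiable almost everywhere. -/
theorem integral_deriv_mul_add_of_lipschitzOn {a : ℝ} (ha : 0 ≤ a) {ρ q q' : ℝ → ℝ} {K : NNReal}
    (hρ : LipschitzOnWith K ρ (Icc 0 a)) (hq : ∀ s, HasDerivAt q (q' s) s) (hq' : Continuous q') :
    ∫ s in Ioo 0 a, (deriv ρ s * q s + ρ s * q' s) = ρ a * q a - ρ 0 * q 0 := by
  have hd : deriv q = q' := funext fun s => (hq s).deriv
  have h1 : AbsolutelyContinuousOnInterval ρ 0 a :=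
    LipschitzOnWith.absolutelyContinuousOnInterval (by rwa [uIcc_of_le ha])
  have h2 : AbsolutelyContinuousOnInterval q 0 a := by
    refine ContDiffOn.absolutelyContinuousOnInterval (ContDiff.contDiffOn ?_)
    rw [contDiff_one_iff_deriv, hd]
    exact ⟨fun s => (hq s).differentiableAt, hq'⟩
  rw [← integral_Ioc_eq_integral_Ioo, ← intervalIntegral.integral_of_le ha, ← hd]
  exact h1.integral_deriv_mul_eq_sub h2

theorem norm_deriv_le_of_lipschitzOn_Icc {a : ℝ} {ρ : ℝ → ℝ} {K : NNReal}
    (hρ : LipschitzOnWith K ρ (Icc 0 a)) : ∀ s ∈ Ioo 0 a, |deriv ρ s| ≤ K := fun _ hs =>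
  norm_deriv_le_of_lipschitzOn (Icc_mem_nhds hs.1 hs.2) hρ

theorem deriv_nonpos_of_antitoneOn_Icc {a : ℝ} {ρ : ℝ → ℝ} (hρ : AntitoneOn ρ (Icc 0 a)) :
    ∀ s ∈ Ioo 0 a, deriv ρ s ≤ 0 := fun s hs => by
  rw [← derivWithin_of_mem_nhds (Icc_mem_nhds hs.1 hs.2)]
  exact hρ.derivWithin_nonpos

variable {𝕜 : Type*} [RCLike 𝕜]

theorem integral_deriv_ofReal_mul_add_of_lipschitzOn {a : ℝ} (ha : 0 ≤ a) {ρ : ℝ → ℝ}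
    {p p' : ℝ → 𝕜} {K : NNReal} (hρ : LipschitzOnWith K ρ (Icc 0 a))
    (hp : ∀ s, HasDerivAt p (p' s) s) (hp' : Continuous p') :
    ∫ s in Ioo 0 a, (((deriv ρ s : ℝ) : 𝕜) * p s + (ρ s : 𝕜) * p' s) =
      (ρ a : 𝕜) * p a - (ρ 0 : 𝕜) * p 0 := by
  have hpc : Continuous p := continuous_iff_continuousAt.2 fun s => (hp s).continuousAt
  have hint : IntegrableOn (fun s => ((deriv ρ s : ℝ) : 𝕜) * p s + (ρ s : 𝕜) * p' s) (Ioo 0 a) := by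
    refine Integrable.add ?_ ?_
    · refine Integrable.bdd_mul (c := K)
        (hpc.integrableOn_Icc.mono_set Ioo_subset_Icc_self)
        (RCLike.continuous_ofReal.comp_aestronglyMeasurable
          (measurable_deriv ρ).aestronglyMeasurable) ?_
      refine (ae_restrict_mem measurableSet_Ioo).mono fun s hs => ?_
      simpa using norm_deriv_le_of_lipschitzOn_Icc hρ s hs
    · exact (((RCLike.continuous_ofReal.comp_continuousOn hρ.continuousOn).mul
        hp'.continuousOn).integrableOn_Icc).mono_set Ioo_subset_Icc_self
  refine RCLike.ext ?_ ?_
  · rw [← integral_re hint]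
    simp only [_root_.map_add, _root_.map_sub, RCLike.re_ofReal_mul]
    exact integral_deriv_mul_add_of_lipschitzOn ha hρ
      (fun s => (RCLike.reCLM : 𝕜 →L[ℝ] ℝ).hasFDerivAt.comp_hasDerivAt s (hp s))
      (RCLike.continuous_re.comp hp')
  · rw [← integral_im hint]
    simp only [_root_.map_add, _root_.map_sub, RCLike.im_ofReal_mul]
    exact integral_deriv_mul_add_of_lipschitzOn ha hρ
      (fun s => (RCLike.imCLM : 𝕜 →L[ℝ] ℝ).hasFDerivAt.comp_hasDerivAt s (hp s))
      (RCLike.continuous_im.comp hp')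

end Weights

/-! ### Coercivity and the operator identity -/

namespace C0Group

variable {𝕜 H U : Type*} [RCLike 𝕜] [NormedAddCommGroup H] [InnerProductSpace 𝕜 H]
  [CompleteSpace H] [NormedAddCommGroup U] [InnerProductSpace 𝕜 U] [CompleteSpace U]

theorem IsOutputMap.weightedForm_incl {S : C0Group 𝕜 H} {B : U →L[𝕜] S.AdjDual} {τ : ℝ}
    {Ψ : H →L[𝕜] Lp U 2 (volume.restrict (Ioo 0 τ))} (hΨ : S.IsOutputMap B τ Ψ) (W : U →L[𝕜] U)
    (w : ℝ → ℝ) (x y : S.AdjDomain) :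
    weightedForm Ψ W w (GraphDomain.incl x) (GraphDomain.incl y) = ∫ s in Ioo 0 τ, (w s : 𝕜) *
      ⟪W (S.bStar B (S.adjOrbit (-s) x)), S.bStar B (S.adjOrbit (-s) y)⟫_𝕜 := by
  refine integral_congr_ae ?_
  filter_upwards [hΨ x, hΨ y] with s h1 h2
  rw [h1, h2]

variable [NormedSpace ℝ H] [IsScalarTower ℝ 𝕜 H]

/-- The integrand is nonnegative, so the part of the integral beyond `T` may be dropped; on `(0, T)`
the bounds `w ≥ a` and `W ≥ c` apply. -/
theorem re_weightedForm_ge {S : C0Group 𝕜 H} {B : U →L[𝕜] S.AdjDual} {T τ : ℝ} (hTτ : T ≤ τ)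
    {Ψ : H →L[𝕜] Lp U 2 (volume.restrict (Ioo 0 τ))} (hΨ : S.IsOutputMap B τ Ψ)
    {W : U →L[𝕜] U} {c : ℝ} (hc : 0 ≤ c) (hW : ∀ u, c * ‖u‖ ^ 2 ≤ RCLike.re ⟪W u, u⟫_𝕜)
    {w : ℝ → ℝ} (hw : AEStronglyMeasurable w (volume.restrict (Ioo 0 τ))) {C : ℝ}
    (hC : ∀ s ∈ Ioo 0 τ, |w s| ≤ C) (hw0 : ∀ s ∈ Ioo 0 τ, 0 ≤ w s) {a : ℝ}
    (ha : ∀ s ∈ Ioo 0 T, a ≤ w s) (z : S.AdjDomain) :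
    a * c * ‖S.outputLp B T z‖ ^ 2 ≤
      RCLike.re (weightedForm Ψ W w (GraphDomain.incl z) (GraphDomain.incl z)) := by
  let k : ℝ → U := fun s => S.bStar B (S.adjOrbit (-s) z)
  have hk : Continuous k := S.continuous_bStar_adjOrbit B z
  have hnn : ∀ u, 0 ≤ RCLike.re ⟪W u, u⟫_𝕜 :=
    fun u => (by positivity : (0:ℝ) ≤ c * ‖u‖ ^ 2).trans (hW u)
  have hi0 := (integrable_weightedForm Ψ W hw hC (GraphDomain.incl z) (GraphDomain.incl z)).re
  have hi : IntegrableOn (fun s => w s * RCLike.re ⟪W (k s), k s⟫_𝕜) (Ioo 0 τ) := by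
    refine hi0.congr ((hΨ z).mono fun s hs => ?_)
    simp only [hs, RCLike.re_ofReal_mul, k]
  have h1 : RCLike.re (weightedForm Ψ W w (GraphDomain.incl z) (GraphDomain.incl z)) =
      ∫ s in Ioo 0 τ, w s * RCLike.re ⟪W (k s), k s⟫_𝕜 := by
    rw [re_weightedForm Ψ hw hC]
    exact integral_congr_ae ((hΨ z).mono fun s hs => by simp only [hs, k])
  rw [h1, norm_outputLp_sq, ← integral_const_mul]
  calc ∫ s in Ioo 0 T, a * c * ‖k s‖ ^ 2
      ≤ ∫ s in Ioo 0 T, w s * RCLike.re ⟪W (k s), k s⟫_𝕜 := by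
        refine setIntegral_mono_on ?_ (hi.mono_set (Ioo_subset_Ioo_right hTτ)) measurableSet_Ioo
          fun s hs => ?_
        · exact ((continuous_const.mul (hk.norm.pow 2)).integrableOn_Icc).mono_set
            Ioo_subset_Icc_self
        · have hs' : 0 ≤ w s := hw0 s (Ioo_subset_Ioo_right hTτ hs)
          rw [mul_assoc]
          exact mul_le_mul (ha s hs) (hW _) (by positivity) hs'
    _ ≤ ∫ s in Ioo 0 τ, w s * RCLike.re ⟪W (k s), k s⟫_𝕜 := by
        refine setIntegral_mono_set hi ?_ (Ioo_subset_Ioo_right hTτ).eventuallyLE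
        exact (ae_restrict_mem measurableSet_Ioo).mono fun s hs => mul_nonneg (hw0 s hs) (hnn _)

/-- Let `p(s) = e^{-2λs} f(s)` with `f(s) = ⟪W B* e^{-sA*} x, B* e^{-sA*} y⟫`. Integrating `(ρ p)'`
leaves `-p(0)`; the term `ρ' p` gives the form of `R`, the derivative of the exponential gives the
`2λ` term, and that of `f` gives the two terms with `x' = A* x` and `y' = A* y`. -/
theorem weightedForm_identity [NormedSpace ℝ U] [IsScalarTower ℝ 𝕜 U] {S : C0Group 𝕜 H}
    {B : U →L[𝕜] S.AdjDual} {τ : ℝ} (hτ : 0 < τ)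
    {Ψ : H →L[𝕜] Lp U 2 (volume.restrict (Ioo 0 τ))} (hΨ : S.IsOutputMap B τ Ψ) (W : U →L[𝕜] U)
    (lam : ℝ) {ρ : ℝ → ℝ} {K : NNReal} (hρ : LipschitzOnWith K ρ (Icc 0 τ)) (hρ0 : ρ 0 = 1)
    (hρτ : ρ τ = 0) {x y x' y' : S.AdjDomain} (hx : GraphDomain.op x = GraphDomain.incl x')
    (hy : GraphDomain.op y = GraphDomain.incl y') :
    weightedForm Ψ W (fun s => ρ s * Real.exp (-2 * lam * s)) (GraphDomain.incl x)
        (GraphDomain.incl y') +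
      weightedForm Ψ W (fun s => ρ s * Real.exp (-2 * lam * s)) (GraphDomain.incl x')
        (GraphDomain.incl y) - ⟪W (S.bStar B x), S.bStar B y⟫_𝕜 +
      weightedForm Ψ W (fun s => -(deriv ρ s) * Real.exp (-2 * lam * s)) (GraphDomain.incl x)
        (GraphDomain.incl y) +
      2 * (lam : 𝕜) * weightedForm Ψ W (fun s => ρ s * Real.exp (-2 * lam * s)) (GraphDomain.incl x)
        (GraphDomain.incl y) = 0 := by
  let k : S.AdjDomain → ℝ → U := fun z s => S.bStar B (S.adjOrbit (-s) z)
  let f : S.AdjDomain → S.AdjDomain → ℝ → 𝕜 := fun z₁ z₂ s => ⟪W (k z₁ s), k z₂ s⟫_𝕜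
  let e : ℝ → ℝ := fun s => Real.exp (-2 * lam * s)
  have hkc : ∀ z, Continuous (k z) := S.continuous_bStar_adjOrbit B
  have hfc : ∀ z₁ z₂, Continuous (f z₁ z₂) := fun z₁ z₂ =>
    (W.continuous.comp (hkc z₁)).inner (hkc z₂)
  have hec : Continuous e := by fun_prop
  have hed : ∀ s, HasDerivAt e (-2 * lam * e s) s := fun s => by
    have := ((hasDerivAt_id s).const_mul (-2 * lam)).exp
    simpa [e, mul_comm] using this
  have hed' : ∀ s, HasDerivAt (fun s => (e s : 𝕜)) ((-2 * lam * e s : ℝ) : 𝕜) s := fun s =>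
    (RCLike.ofRealCLM (K := 𝕜)).hasFDerivAt.comp_hasDerivAt s (hed s)
  have hfd : ∀ s, HasDerivAt (f x y) (-(f x' y s) - f x y' s) s := fun s => by
    have h1 := S.hasDerivAt_bStar_adjOrbit B hx s
    have h2 := S.hasDerivAt_bStar_adjOrbit B hy s
    have h3 : HasDerivAt (fun s => W (k x s)) (-W (k x' s)) s := by
      have := (W.restrictScalars ℝ).hasFDerivAt.comp_hasDerivAt s h1
      simpa [Function.comp_def] using this
    have h4 := h3.inner 𝕜 h2
    rw [inner_neg_left, inner_neg_right] at h4
    refine h4.congr_deriv ?_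
    simp only [f, k]
    ring
  have hpd : ∀ s, HasDerivAt (fun s => (e s : 𝕜) * f x y s)
      (((-2 * lam * e s : ℝ) : 𝕜) * f x y s + (e s : 𝕜) * (-(f x' y s) - f x y' s)) s :=
    fun s => (hed' s).mul (hfd s)
  have hofc : Continuous fun s => (e s : 𝕜) := RCLike.continuous_ofReal.comp hec
  have hibp := integral_deriv_ofReal_mul_add_of_lipschitzOn hτ.le hρ hpd (by
    refine Continuous.add (Continuous.mul (RCLike.continuous_ofReal.comp (by fun_prop))
      (hfc _ _)) (hofc.mul ((hfc _ _).neg.sub (hfc _ _))))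
  have hi : ∀ z₁ z₂, IntegrableOn (fun s => ((ρ s * e s : ℝ) : 𝕜) * f z₁ z₂ s) (Ioo 0 τ) :=
    fun z₁ z₂ => (((RCLike.continuous_ofReal.comp_continuousOn
      (hρ.continuousOn.mul hec.continuousOn)).mul
      (hfc z₁ z₂).continuousOn).integrableOn_Icc).mono_set Ioo_subset_Icc_self
  have hid : IntegrableOn (fun s => ((-(deriv ρ s) * e s : ℝ) : 𝕜) * f x y s) (Ioo 0 τ) := by
    have h0 : IntegrableOn (fun s => ((deriv ρ s : ℝ) : 𝕜) * (-(e s : 𝕜) * f x y s)) (Ioo 0 τ) := by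
      refine Integrable.bdd_mul (c := K)
        ((hofc.neg.mul (hfc x y)).integrableOn_Icc.mono_set Ioo_subset_Icc_self)
        (RCLike.continuous_ofReal.comp_aestronglyMeasurable
          (measurable_deriv ρ).aestronglyMeasurable) ?_
      refine (ae_restrict_mem measurableSet_Ioo).mono fun s hs => ?_
      simpa using norm_deriv_le_of_lipschitzOn_Icc hρ s hs
    refine h0.congr (Eventually.of_forall fun s => ?_)
    simp only [RCLike.ofReal_mul, RCLike.ofReal_neg]
    ring
  rw [hρ0, hρτ] at hibp
  simp only [hΨ.weightedForm_incl]
  have hsum : ∫ s in Ioo 0 τ, (((deriv ρ s : ℝ) : 𝕜) * ((e s : 𝕜) * f x y s) + (ρ s : 𝕜) *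
      (((-2 * lam * e s : ℝ) : 𝕜) * f x y s + (e s : 𝕜) * (-(f x' y s) - f x y' s))) =
      -(∫ s in Ioo 0 τ, ((-(deriv ρ s) * e s : ℝ) : 𝕜) * f x y s)
      - 2 * (lam : 𝕜) * (∫ s in Ioo 0 τ, ((ρ s * e s : ℝ) : 𝕜) * f x y s)
      - (∫ s in Ioo 0 τ, ((ρ s * e s : ℝ) : 𝕜) * f x' y s)
      - ∫ s in Ioo 0 τ, ((ρ s * e s : ℝ) : 𝕜) * f x y' s := by
    have i1 : IntegrableOn (fun s => -(((-(deriv ρ s) * e s : ℝ) : 𝕜) * f x y s) -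
        2 * (lam : 𝕜) * (((ρ s * e s : ℝ) : 𝕜) * f x y s)) (Ioo 0 τ) :=
      hid.neg.sub ((hi x y).const_mul _)
    have i2 : IntegrableOn (fun s => -(((-(deriv ρ s) * e s : ℝ) : 𝕜) * f x y s) -
        2 * (lam : 𝕜) * (((ρ s * e s : ℝ) : 𝕜) * f x y s) -
        ((ρ s * e s : ℝ) : 𝕜) * f x' y s) (Ioo 0 τ) := i1.sub (hi x' y)
    rw [← integral_const_mul, ← integral_neg, ← integral_sub (f := fun s =>
      -(((-(deriv ρ s) * e s : ℝ) : 𝕜) * f x y s)) hid.neg ((hi x y).const_mul _),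
      ← integral_sub i1 (hi x' y), ← integral_sub i2 (hi x y')]
    refine integral_congr_ae (Eventually.of_forall fun s => ?_)
    simp only [RCLike.ofReal_mul, RCLike.ofReal_neg, RCLike.ofReal_ofNat]
    ring
  rw [hsum] at hibp
  have he0 : e 0 = 1 := by simp [e]
  have hf0 : f x y 0 = ⟪W (S.bStar B x), S.bStar B y⟫_𝕜 := by
    simp only [f, k, neg_zero, adjOrbit_zero]
  rw [he0, hf0] at hibp
  simp only [RCLike.ofReal_zero, zero_mul, RCLike.ofReal_one, one_mul, zero_sub] at hibp
  linear_combination -hibp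

/-- Every term is jointly continuous for the graph norm, in which `D((A*)²)` is dense. -/
theorem operatorIdentity_of_dense {S : C0Group 𝕜 H} {B : U →L[𝕜] S.AdjDual} {lam : ℝ}
    {Q R : H →L[𝕜] H} {W : U →L[𝕜] U}
    (h : ∀ x y x' y' : S.AdjDomain, GraphDomain.op x = GraphDomain.incl x' →
      GraphDomain.op y = GraphDomain.incl y' →
      ⟪Q (GraphDomain.incl x), GraphDomain.op y⟫_𝕜 + ⟪GraphDomain.op x, Q (GraphDomain.incl y)⟫_𝕜
      - ⟪W (S.bStar B x), S.bStar B y⟫_𝕜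
      + ⟪R (Q (GraphDomain.incl x)), Q (GraphDomain.incl y)⟫_𝕜
      + 2 * ((lam : ℝ) : 𝕜) * ⟪Q (GraphDomain.incl x), GraphDomain.incl y⟫_𝕜 = 0) :
    S.OperatorIdentity B lam Q R W := by
  have hI : Continuous (GraphDomain.incl : S.AdjDomain →ₗ[𝕜] H) := GraphDomain.continuous_incl
  have hO : Continuous (GraphDomain.op : S.AdjDomain →ₗ[𝕜] H) := GraphDomain.continuous_op
  have hcont : Continuous fun p : S.AdjDomain × S.AdjDomain =>
      ⟪Q (GraphDomain.incl p.1), GraphDomain.op p.2⟫_𝕜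
      + ⟪GraphDomain.op p.1, Q (GraphDomain.incl p.2)⟫_𝕜
      - ⟪W (S.bStar B p.1), S.bStar B p.2⟫_𝕜
      + ⟪R (Q (GraphDomain.incl p.1)), Q (GraphDomain.incl p.2)⟫_𝕜
      + 2 * ((lam : ℝ) : 𝕜) * ⟪Q (GraphDomain.incl p.1), GraphDomain.incl p.2⟫_𝕜 := by
    fun_prop
  have := hcont.ext_on (S.dense_adjDomain_sq.prod S.dense_adjDomain_sq) continuous_const
    (g := fun _ => (0 : 𝕜)) (by
      rintro ⟨x, y⟩ ⟨⟨x', hx⟩, ⟨y', hy⟩⟩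
      exact h x y x' y' hx hy)
  exact fun x y => congrFun this (x, y)

end C0Group

/-! ### Assembly of the theorem -/

theorem mainTheorem6 {𝕜 H U : Type*} [RCLike 𝕜]
    [NormedAddCommGroup H] [InnerProductSpace 𝕜 H] [CompleteSpace H]
    [NormedAddCommGroup U] [InnerProductSpace 𝕜 U] [CompleteSpace U]
    (S : C0Group 𝕜 H) (B : U →L[𝕜] S.AdjDual) (hB : S.Admissible B)
    (T : ℝ) (hT : 0 < T) (hcontrol : S.ExactlyControllable B T)
    (lam Tstar : ℝ) (hTstar : T < Tstar)
    (ρ : ℝ → ℝ) (hρLip : ∃ K : NNReal, LipschitzOnWith K ρ (Icc 0 Tstar))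
    (hρanti : AntitoneOn ρ (Icc 0 Tstar)) (hρ0 : ρ 0 = 1) (hρT : 0 < ρ T)
    (hρTstar : ρ Tstar = 0)
    (W : U →L[𝕜] U) (hW : IsCoerciveSymmetric W) :
    -- there is exactly one bounded extension `Ψ` of `z ↦ B* e^{-sA*} z` from `D(A*)` to `H`
    ∃ Ψ : H →L[𝕜] Lp U 2 (volume.restrict (Ioo 0 Tstar)),
      (∀ Ψ' : H →L[𝕜] Lp U 2 (volume.restrict (Ioo 0 Tstar)),
        S.IsOutputMap B Tstar Ψ' ↔ Ψ' = Ψ) ∧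
      -- the defining formula determines a unique map `Q`, which is linear and bounded
      ∃ Q : H →L[𝕜] H,
        (∀ Q' : H → H,
          (∀ z₁ z₂ : H, ⟪Q' z₁, z₂⟫_𝕜 = C0Group.weightedForm Ψ W
            (fun s => ρ s * Real.exp (-2 * lam * s)) z₁ z₂) ↔ Q' = Q) ∧
        IsCoerciveSymmetric Q ∧ IsUnit Q ∧
        -- the defining formula determines a unique map `R`, which is linear and bounded
        ∃ R : H →L[𝕜] H,
          (∀ R' : H → H,
            (∀ z₁ z₂ : H, ⟪R' (Q z₁), Q z₂⟫_𝕜 = C0Group.weightedForm Ψ W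
              (fun s => -(deriv ρ s) * Real.exp (-2 * lam * s)) z₁ z₂) ↔ R' = R) ∧
          R.IsPositive ∧
          S.OperatorIdentity B lam Q R W := by
  -- Derivatives and Bochner integrals need real structures; restriction of scalars makes them
  -- compatible with `𝕜`.
  let : NormedSpace ℝ H := NormedSpace.restrictScalars ℝ 𝕜 H
  let : NormedSpace ℝ U := NormedSpace.restrictScalars ℝ 𝕜 U
  have : IsScalarTower ℝ 𝕜 H := IsScalarTower.of_algebraMap_smul fun _ _ => rfl
  have : IsScalarTower ℝ 𝕜 U := IsScalarTower.of_algebraMap_smul fun _ _ => rfl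
  have hT' : 0 < Tstar := hT.trans hTstar
  obtain ⟨K, hK⟩ := hρLip
  obtain ⟨hWs, c, hc, hWc⟩ := hW
  obtain ⟨Ψ, hΨ⟩ := hB.exists_unique_outputMap hT'
  have hΨo : S.IsOutputMap B Tstar Ψ := (hΨ Ψ).2 rfl
  have hec : Continuous fun s : ℝ => Real.exp (-2 * lam * s) := by fun_prop
  -- the two weights
  have hwc : ContinuousOn (fun s => ρ s * Real.exp (-2 * lam * s)) (Icc 0 Tstar) :=
    hK.continuousOn.mul hec.continuousOn
  have hwm := (hwc.mono Ioo_subset_Icc_self).aestronglyMeasurable (μ := volume) measurableSet_Ioo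
  obtain ⟨C₁, hC₁⟩ := isCompact_Icc.exists_bound_of_continuousOn hwc
  have hC₁' : ∀ s ∈ Ioo 0 Tstar, |ρ s * Real.exp (-2 * lam * s)| ≤ C₁ :=
    fun s hs => hC₁ s (Ioo_subset_Icc_self hs)
  have hdm : AEStronglyMeasurable (fun s => -(deriv ρ s) * Real.exp (-2 * lam * s))
      (volume.restrict (Ioo 0 Tstar)) :=
    ((measurable_deriv ρ).neg.mul hec.measurable).aestronglyMeasurable
  obtain ⟨C₂, hC₂⟩ := isCompact_Icc.exists_bound_of_continuousOn (s := Icc 0 Tstar) hec.continuousOn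
  have hC₂' : ∀ s ∈ Ioo 0 Tstar, |-(deriv ρ s) * Real.exp (-2 * lam * s)| ≤ K * C₂ := fun s hs => by
    rw [abs_mul, abs_neg]
    exact mul_le_mul (norm_deriv_le_of_lipschitzOn_Icc hK s hs) (hC₂ s (Ioo_subset_Icc_self hs))
      (abs_nonneg _) K.2
  have hwnn : ∀ s ∈ Ioo 0 Tstar, 0 ≤ ρ s * Real.exp (-2 * lam * s) := fun s hs => by
    have := hρanti (Ioo_subset_Icc_self hs) ⟨hT'.le, le_rfl⟩ hs.2.le
    rw [hρTstar] at this
    positivity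
  -- The absolute value makes the lower bound valid for either sign of `lam`.
  have hwT : ∀ s ∈ Ioo 0 T, ρ T * Real.exp (-(2 * |lam| * T)) ≤
      ρ s * Real.exp (-2 * lam * s) := fun s hs => by
    have h1 : ρ T ≤ ρ s := hρanti ⟨hs.1.le, (hs.2.trans hTstar).le⟩ ⟨hT.le, hTstar.le⟩ hs.2.le
    have h2 : lam * s ≤ |lam| * T :=
      mul_le_mul (le_abs_self _) hs.2.le hs.1.le (abs_nonneg _)
    refine mul_le_mul h1 (Real.exp_le_exp.2 (by linarith)) (Real.exp_pos _).le (hρT.le.trans h1)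
  -- the operators attached to the weights
  obtain ⟨Q, hQ⟩ := C0Group.exists_operator_weightedForm Ψ W hwm hC₁'
  obtain ⟨M, hM⟩ := C0Group.exists_operator_weightedForm Ψ W hdm hC₂'
  have hQs : Q.IsSymmetric := fun x y => by
    change ⟪Q x, y⟫_𝕜 = ⟪x, Q y⟫_𝕜
    rw [← inner_conj_symm x, hQ, hQ]
    exact C0Group.weightedForm_symm Ψ hWs x y
  have hMs : M.IsSymmetric := fun x y => by
    change ⟪M x, y⟫_𝕜 = ⟪x, M y⟫_𝕜
    rw [← inner_conj_symm x, hM, hM]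
    exact C0Group.weightedForm_symm Ψ hWs x y
  have hQs' : ∀ x y, ⟪Q x, y⟫_𝕜 = ⟪x, Q y⟫_𝕜 := hQs
  obtain ⟨D, hD, hobs⟩ := hcontrol.exists_norm_incl_le hT
  set a : ℝ := ρ T * Real.exp (-(2 * |lam| * T)) with ha
  have ha0 : 0 < a := by positivity
  -- The factors are the weight bound `a` on `(0, T)`, the coercivity constant `c` of `W` and the
  -- observability constant `D`. The estimate is closed in `x`, so `D(A*)` suffices.
  have hQc : ∀ x, a * c / D ^ 2 * ‖x‖ ^ 2 ≤ RCLike.re ⟪Q x, x⟫_𝕜 := by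
    refine isClosed_property S.dense_range_incl (isClosed_le (by fun_prop)
      (RCLike.continuous_re.comp (by fun_prop))) fun z => ?_
    rw [hQ]
    refine le_trans ?_ (C0Group.re_weightedForm_ge hTstar.le hΨo hc.le hWc hwm hC₁' hwnn hwT z)
    rw [div_mul_eq_mul_div, div_le_iff₀ (by positivity), mul_assoc _ _ (D ^ 2), ← mul_pow,
      mul_comm _ D]
    gcongr
    exact hobs z
  have hα : 0 < a * c / D ^ 2 := by positivity
  have hQu : IsUnit Q := by
    refine ContinuousLinearMap.isUnit_of_forall_le_norm_inner_map Q
      (c := ⟨a * c / D ^ 2, hα.le⟩) hα fun x => ?_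
    rw [mul_comm]
    exact (hQc x).trans (RCLike.re_le_norm _)
  obtain ⟨q, hq⟩ := hQu
  have hinv1 : ∀ x, (↑q⁻¹ : H →L[𝕜] H) (Q x) = x := fun x => by
    rw [← hq, ← mul_apply_eq_comp, Units.inv_mul, one_apply_eq_self]
  have hinv2 : ∀ x, Q ((↑q⁻¹ : H →L[𝕜] H) x) = x := fun x => by
    rw [← hq, ← mul_apply_eq_comp, Units.mul_inv, one_apply_eq_self]
  -- Symmetry of `Q` moves the outer inverse across the inner product, giving `⟪R Q x, Q y⟫ = ⟪M x,
  -- y⟫`.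
  let R : H →L[𝕜] H := (↑q⁻¹ : H →L[𝕜] H) * M * (↑q⁻¹ : H →L[𝕜] H)
  have hR : ∀ x y, ⟪R (Q x), Q y⟫_𝕜 = C0Group.weightedForm Ψ W
      (fun s => -(deriv ρ s) * Real.exp (-2 * lam * s)) x y := fun x y => by
    rw [← hM, ← hQs']
    simp only [R, mul_apply_eq_comp, hinv1, hinv2]
  refine ⟨Ψ, hΨ, Q, fun Q' => ⟨fun h => ?_, ?_⟩, ⟨hQs, _, hα, hQc⟩, ⟨q, hq⟩, R,
    fun R' => ⟨fun h => ?_, ?_⟩, ⟨?_, ?_⟩, ?_⟩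
  · exact funext fun x => ext_inner_right 𝕜 fun y => by rw [h, hQ]
  · rintro rfl
    exact hQ
  -- Surjectivity of `Q` lets the formula, which sees only values on its range, determine the map
  -- everywhere.
  · refine funext fun x => ext_inner_right 𝕜 fun y => ?_
    rw [← hinv2 x, ← hinv2 y, h, hR]
  · rintro rfl
    exact hR
  · intro x y
    change ⟪R x, y⟫_𝕜 = ⟪x, R y⟫_𝕜
    rw [← hinv2 x, ← hinv2 y, hR, ← inner_conj_symm (Q _) (R _), hR]
    exact C0Group.weightedForm_symm Ψ hWs _ _
  · intro x
    rw [ContinuousLinearMap.reApplyInnerSelf_apply, ← hinv2 x, hR,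
      C0Group.re_weightedForm Ψ hdm hC₂']
    refine setIntegral_nonneg measurableSet_Ioo fun s hs => ?_
    refine mul_nonneg (mul_nonneg ?_ (Real.exp_pos _).le) ?_
    · exact neg_nonneg.2 (deriv_nonpos_of_antitoneOn_Icc hρanti s hs)
    · exact le_trans (by positivity) (hWc _)
  · refine C0Group.operatorIdentity_of_dense fun x y x' y' hx hy => ?_
    rw [hR, ← hQs', hx, hy, hQ, hQ, hQ]
    exact C0Group.weightedForm_identity hT' hΨo W lam hK hρ0 hρTstar hx hy
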